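/- Let $\Gamma$ be a non-elementary hyperbolic group, i.e. $\Gamma$ has a finite symmetric generating set whose word metric is Gromov hyperbolic, and no cyclic subgroup of $\Gamma$ has finite index. Write $o$ for the identity of $\Gamma$ and, for a pseudo metric $d$ on $\Gamma$, put $(x|y)_{o,d}=\tfrac12\big(d(x,o)+d(o,y)-d(x,y)\big)$ and, if $d$ is left-invariant, $\ell_d[x]=\lim_{n\to\infty}\tfrac1n d(o,x^n)$ (the stable translation length of $x\in\Gamma$). Let $\mathcal D_\Gamma$ be the set of left-invariant hyperbolic pseudo metrics on $\Gamma$ that are quasi-isometric (via the identity map) to a word metric $d_S$ of a finite symmetric generating set $S$. Let $\overline{\mathcal D}_\Gamma$ be the set of left-invariant pseudo metrics $d$ on $\Gamma$ such that $\ell_d$ is non-constant and there are $\lambda>0$ and $d_0\in\mathcal D_\Gamma$ with $$(x|y)_{o,d}\le \lambda\,(x|y)_{o,d_0}+\lambda\qquad\text{for all }x,y\in\Gamma .$$ Let $\partial_M\mathcal D_\Gamma=\overline{\mathcal D}_\Gamma\setminus\mathcal D_\Gamma$. Let $\Gamma$ act by isometries and without global fixed point on a non-empty $\mathbb R$-tree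 $(T,d_T)$, i.e. a geodesic, $0$-hyperbolic metric space. For $p\in T$, the orbit pseudo metric is $d_T^p(x,y)=d_T(xp,yp)$ for $x,y\in\Gamma$. For a finite symmetric generating set $S$ of $\Gamma$ and $p\in T$, consider the condition $(\mathrm{BBT}_{S,p})$: there is $C\ge 0$ such that for every $x\in\Gamma$ and every geodesic $\gamma\subset\Gamma$ of $d_S$ joining $o$ to $x$, the set $\gamma\cdot p$ is $C$-Hausdorff close to the geodesic of $T$ joining $p$ to $xp$ (each of the two sets lies in the closed $C$-neighbourhood of the other). The action has bounded backtracking if $(\mathrm{BBT}_{S,p})$ holds for some finite symmetric generating set $S$ and some $p\in T$. Then: 1. The action has bounded backtracking if and only if $(\mathrm{BBT}_{S,p})$ holds for every finite symmetric generating set $S$ and every $p\in T$. 2. For every $p\in T$, one has $d_T^p\in\overline{\mathcal D}_\Gamma$ if and only if the action has bounded backtracking. 3. If $\Gamma$ is not virtually free (it has no free subgroup of finite index) and the action has bounded backtracking, then $d_T^p\in\partial_M\mathcal D_\Gamma$ for every $p\in T$. -/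

import Mathlib

open Filter Topology

noncomputable section

namespace HypGroup

/-! ### Gromov products and hyperbolicity -/

/-- The Gromov product `(x|y)_z` with respect to a distance function `d`. -/
def gromovProduct {X : Type*} (d : X → X → ℝ) (z x y : X) : ℝ :=
  (d x z + d z y - d x y) / 2

/-- `δ`-hyperbolicity, by the four-point condition on Gromov products. -/
def IsDeltaHyperbolic {X : Type*} (δ : ℝ) (d : X → X → ℝ) : Prop :=
  ∀ x y z w : X,
    min (gromovProduct d z x w) (gromovProduct d z y w) - δ ≤ gromovProduct d z x y

/-- `d` is hyperbolic if it is `δ`-hyperbolic for some `δ ≥ 0`. -/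
def IsHyperbolic {X : Type*} (d : X → X → ℝ) : Prop :=
  ∃ δ : ℝ, 0 ≤ δ ∧ IsDeltaHyperbolic δ d

/-- Two distance functions on the same set are quasi-isometric if the identity map between them
is a quasi-isometry (the identity is onto, so only the quasi-isometric inequality is needed). -/
def QuasiIsometric {X : Type*} (d d' : X → X → ℝ) : Prop :=
  ∃ L C : ℝ, 0 < L ∧ 0 < C ∧
    ∀ x y : X, L⁻¹ * d x y - C ≤ d' x y ∧ d' x y ≤ L * d x y + C

/-! ### Word metrics and hyperbolic groups -/

section Group

variable {Γ : Type*} [Group Γ]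

/-- `S` is a finite symmetric generating set of the group. -/
structure IsFiniteSymmGen (S : Set Γ) : Prop where
  finite : S.Finite
  symm : ∀ s ∈ S, s⁻¹ ∈ S
  generates : Subgroup.closure S = ⊤

/-- The word length `|x|_S`: the least length of a word in letters of `S` with product `x`. -/
def wordLength (S : Set Γ) (x : Γ) : ℕ :=
  sInf {n : ℕ | ∃ l : List Γ, l.length = n ∧ (∀ s ∈ l, s ∈ S) ∧ l.prod = x}

/-- The word metric `d_S(x,y) = |x⁻¹ y|_S`. -/
def wordDist (S : Set Γ) (x y : Γ) : ℝ :=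
  (wordLength S (x⁻¹ * y) : ℝ)

variable (Γ) in
/-- `Γ` is a hyperbolic group: some word metric for a finite symmetric generating set is
hyperbolic. -/
def IsHyperbolicGroup : Prop :=
  ∃ S : Set Γ, IsFiniteSymmGen S ∧ IsHyperbolic (wordDist S)

variable (Γ) in
/-- `Γ` is non-elementary: it contains no cyclic subgroup of finite index. -/
def IsNonElementary : Prop :=
  ¬ ∃ H : Subgroup Γ, H.FiniteIndex ∧ IsCyclic H

variable (Γ) in
/-- `Γ` is virtually free: it contains a free subgroup of finite index. -/
def IsVirtuallyFree : Prop :=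
  ∃ H : Subgroup Γ, H.FiniteIndex ∧ IsFreeGroup H

/-! ### Spaces of left-invariant pseudo metrics -/

/-- Left invariance of a pseudo metric on a group. -/
def IsLeftInvariant (d : PseudoMetric Γ ℝ) : Prop :=
  ∀ h x y : Γ, d (h * x) (h * y) = d x y

/-- The stable translation length `lim d(1, x ^ n) / n`. -/
def stableLength (d : PseudoMetric Γ ℝ) (x : Γ) : ℝ :=
  limUnder atTop fun n : ℕ => d 1 (x ^ n) / (n : ℝ)

/-- For left-invariant pseudo metrics the limit defining the stable translation length exists. -/
theorem tendsto_stableLength {d : PseudoMetric Γ ℝ} (hd : IsLeftInvariant d) (x : Γ) :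
    Tendsto (fun n : ℕ => d 1 (x ^ n) / (n : ℝ)) atTop (𝓝 (stableLength d x)) := by
  have hsub : Subadditive fun n : ℕ => d 1 (x ^ n) := by
    intro m n
    have h := d.triangle 1 (x ^ m) (x ^ (m + n))
    have h' := hd (x ^ m) 1 (x ^ n)
    rw [mul_one, ← pow_add] at h'
    rwa [h'] at h
  have hbdd : BddBelow (Set.range fun n : ℕ => d 1 (x ^ n) / (n : ℝ)) := by
    refine ⟨0, ?_⟩
    rintro _ ⟨n, rfl⟩
    exact div_nonneg (d.nonneg _ _) (Nat.cast_nonneg n)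
  exact tendsto_nhds_limUnder ⟨_, hsub.tendsto_lim hbdd⟩

variable (Γ) in
/-- `𝒟_Γ`: the left-invariant hyperbolic pseudo metrics on `Γ` that are quasi-isometric to a
word metric. -/
def metricSpaceD : Set (PseudoMetric Γ ℝ) :=
  {d | IsLeftInvariant d ∧ IsHyperbolic (d : Γ → Γ → ℝ) ∧
    ∃ S : Set Γ, IsFiniteSymmGen S ∧ QuasiIsometric (wordDist S) d}

variable (Γ) in
/-- The closure of `𝒟_Γ`: the left-invariant pseudo metrics `d` with non-constant stable
translation length whose Gromov product at the identity is bounded by `lam (x|y) + lam` for the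
Gromov product of some member of `𝒟_Γ` and some `lam > 0`. -/
def closureD : Set (PseudoMetric Γ ℝ) :=
  {d | IsLeftInvariant d ∧ (¬ ∃ c : ℝ, ∀ x : Γ, stableLength d x = c) ∧
    ∃ lam : ℝ, 0 < lam ∧ ∃ d₀ ∈ metricSpaceD Γ,
      ∀ x y : Γ, gromovProduct d 1 x y ≤ lam * gromovProduct d₀ 1 x y + lam}

variable (Γ) in
/-- The Manhattan boundary `∂_M 𝒟_Γ`, the complement of `𝒟_Γ` in its closure. -/
def manhattanBoundaryD : Set (PseudoMetric Γ ℝ) :=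
  closureD Γ \ metricSpaceD Γ

end Group

/-! ### Real trees and bounded backtracking -/

section Tree

variable {T : Type*} [MetricSpace T]

/-- `s` is a geodesic segment from `p` to `q`: the image of an isometric embedding of
`[0, dist p q]` that starts at `p` and ends at `q`. -/
def IsGeodesicSegment (p q : T) (s : Set T) : Prop :=
  ∃ c : ℝ → T, c 0 = p ∧ c (dist p q) = q ∧
    (∀ a ∈ Set.Icc 0 (dist p q), ∀ b ∈ Set.Icc 0 (dist p q), dist (c a) (c b) = |a - b|) ∧
    s = c '' Set.Icc 0 (dist p q)

variable (T) in
/-- An `ℝ`-tree: a geodesic, `0`-hyperbolic metric space. -/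
def IsRTree : Prop :=
  (∀ p q : T, ∃ s : Set T, IsGeodesicSegment p q s) ∧
    IsDeltaHyperbolic 0 (fun x y : T => dist x y)

/-- Each of the two sets lies in the closed `C`-neighbourhood of the other one. -/
def HausdorffClose (C : ℝ) (A B : Set T) : Prop :=
  (∀ a ∈ A, ∃ b ∈ B, dist a b ≤ C) ∧ ∀ b ∈ B, ∃ a ∈ A, dist a b ≤ C

variable {Γ : Type*} [Group Γ]

/-- `γ ⊆ Γ` is a (discrete) geodesic for the word metric `d_S` joining `x` to `y`. -/
def IsWordGeodesic (S : Set Γ) (x y : Γ) (γ : Set Γ) : Prop :=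
  ∃ (n : ℕ) (f : ℕ → Γ), f 0 = x ∧ f n = y ∧
    (∀ i ≤ n, ∀ j ≤ n, wordDist S (f i) (f j) = |(i : ℝ) - (j : ℝ)|) ∧
    γ = f '' Set.Iic n

variable [MulAction Γ T]

/-- Bounded backtracking relative to a generating set `S` and a base point `p`: uniformly over all
`d_S`-geodesics `γ` from the identity to `x`, the set `γ • p` is Hausdorff close to the geodesic
of `T` from `p` to `x • p`. -/
def HasBoundedBacktrackingAt (S : Set Γ) (p : T) : Prop :=
  ∃ C : ℝ, 0 ≤ C ∧ ∀ (x : Γ) (γ : Set Γ), IsWordGeodesic S 1 x γ →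
    ∀ s : Set T, IsGeodesicSegment p (x • p) s → HausdorffClose C ((fun g => g • p) '' γ) s

variable (T Γ) in
/-- The action has bounded backtracking: the condition holds for some finite symmetric generating
set and some base point. -/
def HasBoundedBacktracking : Prop :=
  ∃ S : Set Γ, IsFiniteSymmGen S ∧ ∃ p : T, HasBoundedBacktrackingAt S p

variable (Γ) in
/-- The orbit pseudo metric `(x, y) ↦ dist (x • p) (y • p)` on `Γ`. -/
def orbitPseudoMetric (p : T) : PseudoMetric Γ ℝ where
  toFun x y := dist (x • p) (y • p)
  refl' _ := dist_self _
  symm' _ _ := dist_comm _ _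
  triangle' _ _ _ := dist_triangle _ _ _

end Tree

end HypGroup

end

/-! The theorem is a loop: bounded backtracking for one pair (S, p) puts every orbit metric in the
closure (`orbitPseudoMetric_mem_closureD`), and membership in the closure gives bounded backtracking
at that base point for every S (`hasBoundedBacktrackingAt_of_mem_closureD`). Parts 1 and 2 follow.
The link is that in a tree the Gromov product (x|y)_z is the distance from z to the segment [x,y].

If the orbit metric is in the closure, its Gromov products are controlled by those of some d₀ in
𝒟_Γ. Word geodesics are quasi-geodesics of d₀, so the d₀-product of their endpoints, seen from any
of their points, is bounded (`exists_gromovProduct_le_of_wordGeodesic`). Hence so is the tree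
product, and orbit points stay near the segment. Conversely, a word geodesic from x to y has a point
at word distance at most about (x|y) from the identity (`exists_wordLength_le_gromovProduct`).
Backtracking bounds the tree product seen from that point, and moving the base point back to the
identity costs a multiple of (x|y). Stable lengths are non-constant because a finitely generated
group of elliptic isometries of a tree has a global fixed point (pairwise common fixed points, then
Helly).

For part 3, an orbit metric in 𝒟_Γ would be quasi-isometric to a word metric, so the action would be
metrically proper. Medians of orbit points then form a locally finite combinatorial tree whose
vertices carry uniformly finite equivariant families of group elements, which forces Γ to be
virtually free. -/

noncomputable section

namespace HypGroup

/-! ### Stability of quasi-geodesics in hyperbolic pseudo metrics -/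

section Morse

variable {X : Type*}

theorem gromovProduct_comm (d : PseudoMetric X ℝ) (z x y : X) :
    gromovProduct d z x y = gromovProduct d z y x := by
  unfold gromovProduct
  linarith [d.symm x z, d.symm y z, d.symm x y]

theorem gromovProduct_nonneg (d : PseudoMetric X ℝ) (z x y : X) : 0 ≤ gromovProduct d z x y := by
  unfold gromovProduct
  linarith [d.triangle x z y]

theorem gromovProduct_le_left (d : PseudoMetric X ℝ) (z x y : X) :
    gromovProduct d z x y ≤ d x z := by
  unfold gromovProduct
  linarith [d.triangle z x y, d.symm x z]

theorem gromovProduct_le_right (d : PseudoMetric X ℝ) (z x y : X) :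
    gromovProduct d z x y ≤ d z y := by
  unfold gromovProduct
  linarith [d.triangle x y z, d.symm y z]

theorem gromovProduct_le_add (d : PseudoMetric X ℝ) (z w x y : X) :
    gromovProduct d z x y ≤ gromovProduct d w x y + d z w := by
  unfold gromovProduct
  linarith [d.triangle x w z, d.triangle z w y, d.symm z w]

/-- The four-point inequality in terms of distances. -/
theorem IsDeltaHyperbolic.fourPoint {δ : ℝ} {d : PseudoMetric X ℝ}
    (h : IsDeltaHyperbolic δ d) (x y z w : X) :
    d x y + d z w ≤ max (d x w + d z y) (d y w + d z x) + 2 * δ := by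
  have := h x y z w
  unfold gromovProduct at this
  have e1 := d.symm x z
  have e2 := d.symm y z
  have e3 := d.symm w z
  rcases le_total (d x w + d z y) (d y w + d z x) with h1 | h1
  · rw [max_eq_right h1]
    rcases min_le_iff.1 (sub_le_iff_le_add.1 this) with h2 | h2 <;> linarith
  · rw [max_eq_left h1]
    rcases min_le_iff.1 (sub_le_iff_le_add.1 this) with h2 | h2 <;> linarith

/-- A function satisfying the four-point inequality against `d`: the distance function of a point
of a hyperbolic extension of the space. -/
def IsVirtualPoint (δ : ℝ) (d : PseudoMetric X ℝ) (r : X → ℝ) : Prop :=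
  ∀ z w u : X, d z w + r u ≤ max (d z u + r w) (d w u + r z) + 2 * δ

/-- The point at distance `t` from `g` on a geodesic from `g` to `x`. -/
def virtualDist (d : PseudoMetric X ℝ) (g x : X) (t : ℝ) (z : X) : ℝ :=
  max (d z g - t) (d z x - d g x + t)

/-- `d` need not have geodesics, so their points are replaced by this maximum, which in a tree is
the true distance. Each of its two terms is a distance function shifted by a constant, hence
inherits the four-point inequality, and the value at `u` is one of the two. -/
theorem isVirtualPoint_virtualDist {δ : ℝ} {d : PseudoMetric X ℝ} (h : IsDeltaHyperbolic δ d)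
    (g x : X) (t : ℝ) : IsVirtualPoint δ d (virtualDist d g x t) := by
  intro z w u
  have l1 : ∀ a, d a g - t ≤ virtualDist d g x t a := fun a => le_max_left _ _
  have l2 : ∀ a, d a x - d g x + t ≤ virtualDist d g x t a := fun a => le_max_right _ _
  have key : ∀ q c, (∀ a, d a q + c ≤ virtualDist d g x t a) →
      d z w + (d u q + c) ≤ max (d z u + virtualDist d g x t w)
        (d w u + virtualDist d g x t z) + 2 * δ := by
    intro q c hq
    have h1 := h.fourPoint z w q u
    rw [d.symm q u, d.symm q w, d.symm q z] at h1
    have : max (d z u + d w q) (d w u + d z q) ≤ max (d z u + virtualDist d g x t w)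
        (d w u + virtualDist d g x t z) - c := by
      rw [le_sub_iff_add_le, ← max_add_add_right]
      exact max_le_max (by linarith [hq w]) (by linarith [hq z])
    linarith
  have k1 := key g (-t) (fun a => by linarith [l1 a])
  have k2 := key x (- d g x + t) (fun a => by linarith [l2 a])
  have : virtualDist d g x t u = max (d u g - t) (d u x - d g x + t) := rfl
  rcases max_choice (d u g - t) (d u x - d g x + t) with h3 | h3 <;>
    rw [this, h3] <;> linarith

/-- The right-hand side is the Gromov product of the endpoints seen from the virtual point. Cutting
the path in half costs one `δ`, so a path of length `2 ^ k` costs `k * δ`: the source of all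
logarithmic bounds below. -/
theorem IsVirtualPoint.chain {δ K D : ℝ} (hK : 0 ≤ K) {d : PseudoMetric X ℝ}
    {r : X → ℝ} (hr : IsVirtualPoint δ d r) (k : ℕ) :
    ∀ (f : ℕ → X) (m : ℕ), m ≤ 2 ^ k → (∀ i ≤ m, D ≤ r (f i)) →
      (∀ i < m, d (f i) (f (i + 1)) ≤ K) →
      D - K / 2 - k * δ ≤ (r (f 0) + r (f m) - d (f 0) (f m)) / 2 := by
  induction k with
  | zero =>
    intro f m hm hD hf
    have : m = 0 ∨ m = 1 := by simp at hm; omega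
    rcases this with rfl | rfl
    · have := hD 0 le_rfl
      simp; linarith
    · have h0 := hD 0 (by simp)
      have h1 := hD 1 le_rfl
      have h2 := hf 0 (by simp)
      simp at h2 ⊢; linarith
  | succ k ih =>
    intro f m hm hD hf
    have hp : 2 ^ (k + 1) = 2 * 2 ^ k := by ring
    have h1 := ih f (m / 2) (by omega) (fun i hi => hD i (by omega)) (fun i hi => hf i (by omega))
    have h2 := ih (fun i => f (m / 2 + i)) (m - m / 2) (by omega)
      (fun i hi => hD _ (by omega)) (fun i hi => hf _ (by omega))
    have h3 : m / 2 + (m - m / 2) = m := by omega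
    simp only [add_zero, h3] at h2
    have h4 := hr (f 0) (f m) (f (m / 2))
    rw [d.symm (f m)] at h4
    push_cast
    rcases max_choice (d (f 0) (f (m / 2)) + r (f m)) (d (f (m / 2)) (f m) + r (f 0)) with h5 | h5 <;>
      rw [h5] at h4 <;> linarith

/-- A path from `g` to `x` of length at most `2 ^ k` comes close to any intermediate point. -/
theorem exists_virtualDist_le {δ K : ℝ} (hK : 0 ≤ K) {d : PseudoMetric X ℝ}
    (h : IsDeltaHyperbolic δ d) {k m : ℕ} (f : ℕ → X) (hm : m ≤ 2 ^ k)
    (hf : ∀ i < m, d (f i) (f (i + 1)) ≤ K) {t : ℝ} (h0 : 0 ≤ t) (h1 : t ≤ d (f 0) (f m)) :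
    ∃ a ≤ m, virtualDist d (f 0) (f m) t (f a) ≤ K / 2 + k * δ := by
  obtain ⟨a, ha, hmin⟩ := Finset.exists_min_image (Finset.range (m + 1))
    (fun i => virtualDist d (f 0) (f m) t (f i)) ⟨0, by simp⟩
  refine ⟨a, by simpa [Nat.lt_succ_iff] using ha, ?_⟩
  -- The virtual point lies between the endpoints, so their product seen from it is 0 (`e0`, `e1`);
  -- the chain bound then limits the minimum.
  have := (isVirtualPoint_virtualDist h (f 0) (f m) t).chain hK k f m hm
    (fun i hi => hmin i (by simpa [Nat.lt_succ_iff] using hi)) hf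
  have e0 : virtualDist d (f 0) (f m) t (f 0) = t := by
    unfold virtualDist
    rw [d.refl]
    exact (max_eq_right (by linarith)).trans (by ring)
  have e1 : virtualDist d (f 0) (f m) t (f m) = d (f 0) (f m) - t := by
    unfold virtualDist
    rw [d.refl, d.symm (f m)]
    exact max_eq_left (by linarith)
  rw [e0, e1] at this
  linarith

/-- Up to time (x|y)_g the geodesics from `g` to `x` and to `y` fellow-travel, so their points at
time `t` are almost the same point, through which `z` and `w` can be joined. -/
theorem dist_le_virtualDist_add {δ : ℝ} {d : PseudoMetric X ℝ} (hδ : 0 ≤ δ)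
    (h : IsDeltaHyperbolic δ d) {g x y z w : X} {t : ℝ} (ht : t ≤ gromovProduct d g x y) :
    d z w ≤ virtualDist d g x t z + virtualDist d g y t w + 4 * δ := by
  have z1 : d z g - t ≤ virtualDist d g x t z := le_max_left _ _
  have z2 : d z x - d g x + t ≤ virtualDist d g x t z := le_max_right _ _
  have w1 : d w g - t ≤ virtualDist d g y t w := le_max_left _ _
  have w2 : d w y - d g y + t ≤ virtualDist d g y t w := le_max_right _ _
  have h1 := h z y g x
  have h2 := h z w g y
  unfold gromovProduct at *
  have e1 := d.symm x g
  have e2 := d.symm y g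
  have e3 := d.symm z g
  have e4 := d.symm w g
  have e5 := d.symm x y
  rcases min_le_iff.1 (sub_le_iff_le_add.1 h1) with h3 | h3 <;>
  rcases min_le_iff.1 (sub_le_iff_le_add.1 h2) with h4 | h4 <;> linarith

/-- The path `f 0, …, f n` has steps of length at most `K` and is parametrised up to the affine
control `L, A` by distance. -/
structure IsQuasiGeodesic (d : PseudoMetric X ℝ) (K L A : ℝ) (f : ℕ → X) (n : ℕ) : Prop where
  step : ∀ i < n, d (f i) (f (i + 1)) ≤ K
  lower : ∀ i ≤ n, ∀ j ≤ n, |(i : ℝ) - j| ≤ L * d (f i) (f j) + A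

theorem IsQuasiGeodesic.shift {d : PseudoMetric X ℝ} {K L A : ℝ} {f : ℕ → X} {n : ℕ}
    (h : IsQuasiGeodesic d K L A f n) (a m : ℕ) (ham : a + m ≤ n) :
    IsQuasiGeodesic d K L A (fun i => f (a + i)) m where
  step i hi := h.step (a + i) (by omega)
  lower i hi j hj := by
    have := h.lower (a + i) (by omega) (a + j) (by omega)
    push_cast at this
    rwa [add_sub_add_left_eq_sub] at this

theorem IsQuasiGeodesic.reverse {d : PseudoMetric X ℝ} {K L A : ℝ} {f : ℕ → X} {n : ℕ}
    (h : IsQuasiGeodesic d K L A f n) : IsQuasiGeodesic d K L A (fun i => f (n - i)) n where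
  step i hi := by
    have := h.step (n - (i + 1)) (by omega)
    rw [d.symm]
    rwa [show n - (i + 1) + 1 = n - i by omega] at this
  lower i hi j hj := by
    have := h.lower (n - i) (by omega) (n - j) (by omega)
    rw [Nat.cast_sub hi, Nat.cast_sub hj, abs_sub_comm] at this
    simpa using this

theorem IsQuasiGeodesic.dist_le {d : PseudoMetric X ℝ} {K L A : ℝ} {f : ℕ → X} {n : ℕ}
    (h : IsQuasiGeodesic d K L A f n) (i m : ℕ) (him : i + m ≤ n) :
    d (f i) (f (i + m)) ≤ m * K := by
  induction m with
  | zero => simp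
  | succ m ih =>
    have h1 := ih (by omega)
    have h2 := h.step (i + m) (by omega)
    have h3 := d.triangle (f i) (f (i + m)) (f (i + m + 1))
    push_cast
    rw [← add_assoc]
    linarith

/-- A logarithmic bound for Gromov products along quasi-geodesics. -/
theorem IsQuasiGeodesic.gromovProduct_le_log {δ K L A : ℝ} (hδ : 0 ≤ δ) (hK : 0 ≤ K) (hL : 0 ≤ L)
    {d : PseudoMetric X ℝ} (h : IsDeltaHyperbolic δ d) {f : ℕ → X} {n k : ℕ}
    (hf : IsQuasiGeodesic d K L A f n) (hn : n ≤ 2 ^ k) {i : ℕ} (hi : i ≤ n) :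
    gromovProduct d (f i) (f 0) (f n) ≤
      (K / 2 + k * δ) + K * (L * (2 * (K / 2 + k * δ) + 4 * δ) + A) := by
  set t := gromovProduct d (f i) (f 0) (f n) with ht
  have t0 : 0 ≤ t := gromovProduct_nonneg _ _ _ _
  -- The path passes, `a` steps before `i` and `b` steps after, near the points at distance `t`
  -- towards the two ends. These nearly coincide, so the lower quasi-geodesic bound limits `a`;
  -- since `t` is at most `a * K` plus an error, `t` is limited too.
  obtain ⟨a, ha, hra⟩ := exists_virtualDist_le hK h (k := k) (m := i) (fun j => f (i - j))
    (by omega)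
    (fun j hj => by
      have := hf.step (i - (j + 1)) (by omega)
      rw [d.symm]
      rwa [show i - (j + 1) + 1 = i - j by omega] at this) t0
    (by
      simp only [tsub_zero, tsub_self]
      rw [d.symm]
      exact gromovProduct_le_left d (f i) (f 0) (f n))
  obtain ⟨b, hb, hrb⟩ := exists_virtualDist_le hK h (k := k) (m := n - i) (fun j => f (i + j))
    (by omega) (fun j hj => hf.step (i + j) (by omega)) t0
    (by
      simp only [add_zero, Nat.add_sub_cancel' hi]
      exact gromovProduct_le_right d (f i) (f 0) (f n))
  simp only [tsub_zero, tsub_self, add_zero, Nat.add_sub_cancel' hi] at hra hrb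
  have h1 := dist_le_virtualDist_add (z := f (i - a)) (w := f (i + b)) hδ h ht.le
  have h2 := hf.lower (i - a) (by omega) (i + b) (by omega)
  have h3 : (a : ℝ) ≤ |((i - a : ℕ) : ℝ) - ((i + b : ℕ) : ℝ)| := by
    rw [abs_sub_comm]
    refine le_trans ?_ (le_abs_self _)
    rw [Nat.cast_sub ha]
    push_cast
    have : (0 : ℝ) ≤ b := Nat.cast_nonneg b
    linarith
  have h4 := hf.dist_le (i - a) a (by omega)
  rw [Nat.sub_add_cancel ha] at h4
  have h5 : d (f (i - a)) (f 0) - d (f i) (f 0) + t ≤ virtualDist d (f i) (f 0) t (f (i - a)) :=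
    le_max_right _ _
  have h6 := d.triangle (f i) (f (i - a)) (f 0)
  rw [d.symm (f i) (f (i - a))] at h6
  have h7 : (a : ℝ) ≤ L * (2 * (K / 2 + k * δ) + 4 * δ) + A := by
    refine h3.trans (h2.trans ?_)
    gcongr
    linarith
  have h8 : (a : ℝ) * K ≤ (L * (2 * (K / 2 + k * δ) + 4 * δ) + A) * K := by gcongr
  linarith

/-- Local-to-global principle, one-sided version. -/
theorem IsDeltaHyperbolic.gromovProduct_le_of_local {δ C : ℝ} {d : PseudoMetric X ℝ}
    (h : IsDeltaHyperbolic δ d) {s n : ℕ} (hs : 0 < s) {f : ℕ → X} (hδ : 0 ≤ δ)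
    (h1 : ∀ i < s, i + s ≤ n → gromovProduct d (f i) (f 0) (f (i + s)) ≤ C)
    (h2 : ∀ i, i + s + s ≤ n → gromovProduct d (f (i + s)) (f i) (f (i + s + s)) ≤ C)
    (h3 : ∀ i, i + s ≤ n → 2 * C + 2 * δ < d (f i) (f (i + s))) (i : ℕ) (hi : i + s ≤ n) :
    gromovProduct d (f i) (f 0) (f (i + s)) ≤ C + δ := by
  induction i using Nat.strong_induction_on with
  | _ i ih =>
    rcases lt_or_ge i s with his | his
    · exact (h1 i his hi).trans (by linarith)
    · obtain ⟨j, rfl⟩ := Nat.exists_eq_add_of_le' his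
      have i1 := ih j (by omega) (by omega)
      have i2 := h2 j hi
      have i3 := h3 j (by omega)
      have i4 := h (f j) (f (j + s + s)) (f (j + s)) (f 0)
      rw [gromovProduct_comm d _ (f (j + s + s))] at i4
      -- The second summand is at most `C + δ` by induction and the sum exceeds `2 * C + 2 * δ`, so
      -- the first cannot realise the minimum in `i4`.
      have i5 : gromovProduct d (f (j + s)) (f j) (f 0) + gromovProduct d (f j) (f 0) (f (j + s))
          = d (f j) (f (j + s)) := by
        unfold gromovProduct
        linarith [d.symm (f j) (f 0), d.symm (f (j + s)) (f 0)]
      rcases min_le_iff.1 (sub_le_iff_le_add.1 i4) with i6 | i6 <;> linarith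

theorem exists_linear_le_two_pow (a b : ℝ) : ∃ k : ℕ, a * k + b < 2 ^ k := by
  have h1 := (tendsto_pow_const_div_const_pow_of_one_lt 1 (one_lt_two (α := ℝ))).const_mul a
  have h2 := (tendsto_pow_const_div_const_pow_of_one_lt 0 (one_lt_two (α := ℝ))).const_mul b
  have h3 := (h1.add h2).eventually (gt_mem_nhds (show a * 0 + b * 0 < (1 : ℝ) by simp))
  obtain ⟨k, hk⟩ := h3.exists
  refine ⟨k, ?_⟩
  have : (0 : ℝ) < 2 ^ k := by positivity
  rw [← mul_div_assoc, ← mul_div_assoc, ← add_div, div_lt_one this] at hk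
  simpa using hk

/-- Gromov products along quasi-geodesics are uniformly bounded. -/
theorem exists_gromovProduct_le_of_isQuasiGeodesic {δ K L A : ℝ} (hδ : 0 ≤ δ) (hK : 0 ≤ K)
    (hL : 0 < L) {d : PseudoMetric X ℝ} (h : IsDeltaHyperbolic δ d) :
    ∃ C, 0 ≤ C ∧ ∀ (f : ℕ → X) (n : ℕ), IsQuasiGeodesic d K L A f n → ∀ i ≤ n,
      gromovProduct d (f i) (f 0) (f n) ≤ C := by
  -- On windows of length `2 ^ (k + 1)` the logarithmic bound `C` is affine in `k`, while points `2
  -- ^ k` steps apart are at distance at least linear in `2 ^ k`. The two coefficients are those of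
  -- `L * (2 * C + 3 * δ) + A` as a function of `k`.
  obtain ⟨k, hk⟩ := exists_linear_le_two_pow (L * (2 * (δ + K * (L * (2 * δ)))))
    (L * (2 * (K / 2 + δ + K * (L * (2 * (K / 2 + δ) + 4 * δ) + A)) + 3 * δ) + A)
  set s := 2 ^ k with hs
  have hs0 : 0 < s := by positivity
  set C := (K / 2 + (k + 1 : ℕ) * δ) + K * (L * (2 * (K / 2 + (k + 1 : ℕ) * δ) + 4 * δ) + A)
    with hC
  have hk' : L * (2 * C + 3 * δ) + A < s := by
    have : (s : ℝ) = 2 ^ k := by simp [hs]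
    rw [this]
    refine lt_of_eq_of_lt ?_ hk
    rw [hC]; push_cast; ring
  have far : ∀ (f : ℕ → X) (n : ℕ), IsQuasiGeodesic d K L A f n → ∀ i, i + s ≤ n →
      2 * C + 3 * δ < d (f i) (f (i + s)) := by
    intro f n hf i hi
    have h1 := hf.lower (i + s) hi i (by omega)
    rw [d.symm] at h1
    push_cast at h1
    rw [add_sub_cancel_left, abs_of_nonneg (by positivity)] at h1
    have : L * (2 * C + 3 * δ) < L * d (f i) (f (i + s)) := by linarith
    exact lt_of_mul_lt_mul_left this hL.le
  have onesided : ∀ (f : ℕ → X) (n : ℕ), IsQuasiGeodesic d K L A f n → ∀ i, i + s ≤ n →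
      gromovProduct d (f i) (f 0) (f (i + s)) ≤ C + δ := by
    intro f n hf i hi
    have hp : 2 ^ (k + 1) = 2 * s := by rw [hs]; ring
    refine h.gromovProduct_le_of_local hs0 hδ (n := n) ?_ ?_ ?_ i hi
    · intro i his hi
      have := (hf.shift 0 (i + s) (by omega)).gromovProduct_le_log hδ hK hL.le h (k := k + 1)
        (by omega) (i := i) (by omega)
      simp only [zero_add] at this
      exact this
    · intro i hi
      have := (hf.shift i (s + s) (by omega)).gromovProduct_le_log hδ hK hL.le h (k := k + 1)
        (by omega) (i := s) (by omega)
      simp only [add_zero, ← Nat.add_assoc] at this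
      exact this
    · intro i hi
      linarith [far f n hf i hi]
  refine ⟨max (s * K) (C + 2 * δ), le_max_of_le_left (by positivity), ?_⟩
  intro f n hf i hi
  rcases lt_or_ge i s with h1 | h1
  · refine le_max_of_le_left ((gromovProduct_le_left _ _ _ _).trans ?_)
    have := hf.dist_le 0 i (by omega)
    rw [zero_add] at this
    refine this.trans ?_
    gcongr
  rcases lt_or_ge (n - i) s with h2 | h2
  · refine le_max_of_le_left ((gromovProduct_le_right _ _ _ _).trans ?_)
    have := hf.dist_le i (n - i) (by omega)
    rw [Nat.add_sub_cancel' hi] at this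
    refine this.trans ?_
    gcongr
  refine le_max_of_le_right ?_
  -- The past seen from `i` and, by reversal, the future seen from `i + s` are controlled; the extra
  -- `δ` in `far` allows one more four-point step to glue them.
  have a1 := onesided f n hf i (by omega)
  have a2 := onesided _ n hf.reverse (n - (i + s)) (by omega)
  have a3 := far f n hf i (by omega)
  simp only [tsub_zero] at a2
  rw [show n - (n - (i + s)) = i + s by omega,
    show n - (n - (i + s) + s) = i by omega] at a2
  have a4 := h (f 0) (f (i + s)) (f i) (f n)
  have a5 : gromovProduct d (f i) (f (i + s)) (f n) + gromovProduct d (f (i + s)) (f n) (f i)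
      = d (f i) (f (i + s)) := by
    unfold gromovProduct
    linarith [d.symm (f n) (f i), d.symm (f (i + s)) (f n), d.symm (f (i + s)) (f i)]
  rcases min_le_iff.1 (sub_le_iff_le_add.1 a4) with a6 | a6 <;> linarith

end Morse

/-! ### Word metrics -/

section Word

variable {Γ : Type*} [Group Γ]

theorem IsFiniteSymmGen.exists_word {S : Set Γ} (hS : IsFiniteSymmGen S) (x : Γ) :
    ∃ l : List Γ, l.length = wordLength S x ∧ (∀ s ∈ l, s ∈ S) ∧ l.prod = x := by
  have hx : x ∈ Submonoid.closure (S ∪ S⁻¹) := by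
    rw [← Subgroup.closure_toSubmonoid, hS.generates]
    trivial
  obtain ⟨l, hl, rfl⟩ := Submonoid.exists_list_of_mem_closure hx
  have : ({n : ℕ | ∃ l' : List Γ, l'.length = n ∧ (∀ s ∈ l', s ∈ S) ∧ l'.prod = l.prod}).Nonempty :=
    ⟨l.length, l, rfl, fun s hs => (hl s hs).elim id fun h => by simpa using hS.symm _ h, rfl⟩
  exact Nat.sInf_mem this

theorem wordLength_prod_le {S : Set Γ} (l : List Γ) (hl : ∀ s ∈ l, s ∈ S) :
    wordLength S l.prod ≤ l.length :=
  Nat.sInf_le ⟨l, rfl, hl, rfl⟩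

theorem wordLength_one (S : Set Γ) : wordLength S 1 = 0 := by
  simpa using wordLength_prod_le (S := S) [] (by simp)

theorem IsFiniteSymmGen.wordLength_mul_le {S : Set Γ} (hS : IsFiniteSymmGen S) (x y : Γ) :
    wordLength S (x * y) ≤ wordLength S x + wordLength S y := by
  obtain ⟨l, hl, hlS, rfl⟩ := hS.exists_word x
  obtain ⟨m, hm, hmS, rfl⟩ := hS.exists_word y
  rw [← hl, ← hm, ← List.prod_append, ← List.length_append]
  exact wordLength_prod_le _ fun s hs => (List.mem_append.1 hs).elim (hlS s) (hmS s)

theorem IsFiniteSymmGen.wordLength_inv_le {S : Set Γ} (hS : IsFiniteSymmGen S) (x : Γ) :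
    wordLength S x⁻¹ ≤ wordLength S x := by
  obtain ⟨l, hl, hlS, rfl⟩ := hS.exists_word x
  rw [← hl, List.prod_inv_reverse]
  refine (wordLength_prod_le _ ?_).trans (by simp)
  intro s hs
  simp only [List.mem_reverse, List.mem_map] at hs
  obtain ⟨t, ht, rfl⟩ := hs
  exact hS.symm _ (hlS t ht)

theorem IsFiniteSymmGen.wordLength_inv {S : Set Γ} (hS : IsFiniteSymmGen S) (x : Γ) :
    wordLength S x⁻¹ = wordLength S x :=
  le_antisymm (hS.wordLength_inv_le x) (by simpa using hS.wordLength_inv_le x⁻¹)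

/-- The word metric as a pseudo metric. -/
def wordPseudoMetric (S : Set Γ) (hS : IsFiniteSymmGen S) : PseudoMetric Γ ℝ where
  toFun := wordDist S
  refl' x := by simp [wordDist, wordLength_one]
  symm' x y := by
    unfold wordDist
    rw [← hS.wordLength_inv]
    simp
  triangle' x y z := by
    unfold wordDist
    have := hS.wordLength_mul_le (x⁻¹ * y) (y⁻¹ * z)
    rw [show x⁻¹ * y * (y⁻¹ * z) = x⁻¹ * z by group] at this
    exact_mod_cast this

theorem wordPseudoMetric_apply {S : Set Γ} (hS : IsFiniteSymmGen S) (x y : Γ) :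
    wordPseudoMetric S hS x y = wordDist S x y := rfl

theorem isLeftInvariant_wordPseudoMetric {S : Set Γ} (hS : IsFiniteSymmGen S) :
    IsLeftInvariant (wordPseudoMetric S hS) := by
  intro h x y
  simp only [wordPseudoMetric_apply, wordDist]
  congr 2
  group

theorem wordPseudoMetric_mem_metricSpaceD {S : Set Γ} (hS : IsFiniteSymmGen S)
    (h : IsHyperbolic (wordDist S)) : wordPseudoMetric S hS ∈ metricSpaceD Γ := by
  refine ⟨isLeftInvariant_wordPseudoMetric hS, h, S, hS, 1, 1, one_pos, one_pos, fun x y => ?_⟩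
  rw [wordPseudoMetric_apply]
  constructor <;> linarith

/-- Every left-invariant pseudo metric is dominated by a multiple of any word metric. -/
theorem IsLeftInvariant.exists_le_wordDist {d : PseudoMetric Γ ℝ} (hd : IsLeftInvariant d)
    {S : Set Γ} (hS : IsFiniteSymmGen S) :
    ∃ K, 0 < K ∧ ∀ x y, d x y ≤ K * wordDist S x y := by
  obtain ⟨K, hK⟩ := (hS.finite.image (fun s => d 1 s)).bddAbove
  refine ⟨max K 1, by positivity, fun x y => ?_⟩
  have key : ∀ l : List Γ, (∀ s ∈ l, s ∈ S) → d 1 l.prod ≤ max K 1 * l.length := by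
    intro l hl
    induction l with
    | nil => simp
    | cons a l ih =>
      have h1 := ih fun s hs => hl s (List.mem_cons_of_mem _ hs)
      have h2 : d 1 a ≤ K := hK ⟨a, hl a (by simp), rfl⟩
      have h3 := d.triangle 1 a (a * l.prod)
      have h4 := hd a 1 l.prod
      rw [mul_one] at h4
      rw [List.prod_cons, List.length_cons]
      push_cast
      linarith [le_max_left K 1]
  obtain ⟨l, hl, hlS, hx⟩ := hS.exists_word (x⁻¹ * y)
  have h1 := key l hlS
  have h2 := hd x 1 (x⁻¹ * y)
  rw [mul_one, mul_inv_cancel_left] at h2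
  rw [h2, wordDist, ← hl, ← hx]
  exact h1

theorem IsFiniteSymmGen.finite_wordLength_le {S : Set Γ} (hS : IsFiniteSymmGen S) (n : ℕ) :
    {x : Γ | wordLength S x ≤ n}.Finite := by
  have : {x : Γ | wordLength S x ≤ n} ⊆ List.prod '' {l : List Γ | l.length ≤ n ∧ ∀ s ∈ l, s ∈ S} := by
    intro x hx
    obtain ⟨l, hl, hlS, rfl⟩ := hS.exists_word x
    exact ⟨l, ⟨hl ▸ hx, hlS⟩, rfl⟩
  refine Set.Finite.subset (Set.Finite.image _ ?_) this
  have := hS.finite.to_subtype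
  have hfin := List.finite_length_le S n
  refine (hfin.image (List.map Subtype.val)).subset ?_
  rintro l ⟨hl, hlS⟩
  lift l to List S using hlS
  exact ⟨l, by simpa using hl, rfl⟩

/-- Geodesics exist for word metrics. -/
theorem IsFiniteSymmGen.exists_wordGeodesic {S : Set Γ} (hS : IsFiniteSymmGen S) (x y : Γ) :
    ∃ (n : ℕ) (f : ℕ → Γ), f 0 = x ∧ f n = y ∧
      ∀ i ≤ n, ∀ j ≤ n, wordDist S (f i) (f j) = |(i : ℝ) - (j : ℝ)| := by
  obtain ⟨l, hl, hlS, hx⟩ := hS.exists_word (x⁻¹ * y)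
  set d := wordPseudoMetric S hS
  have inv := isLeftInvariant_wordPseudoMetric hS
  refine ⟨l.length, fun i => x * (l.take i).prod, by simp, by simp [hx], ?_⟩
  have upper : ∀ i j, i ≤ j → j ≤ l.length →
      d (x * (l.take i).prod) (x * (l.take j).prod) ≤ (j : ℝ) - i := by
    intro i j hij hj
    have h1 : (l.take j).prod = (l.take i).prod * ((l.take j).drop i).prod := by
      rw [← List.prod_take_mul_prod_drop (l.take j) i, List.take_take, min_eq_left hij]
    rw [inv, h1, wordPseudoMetric_apply, wordDist, inv_mul_cancel_left, ← Nat.cast_sub hij]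
    have := wordLength_prod_le (S := S) ((l.take j).drop i)
      fun s hs => hlS s (List.mem_of_mem_take (List.mem_of_mem_drop hs))
    refine Nat.cast_le.2 (this.trans ?_)
    simp [min_eq_left hj]
  have total : d (x * (l.take 0).prod) (x * (l.take l.length).prod) = l.length := by
    rw [inv, wordPseudoMetric_apply, wordDist, List.take_length, List.take_zero, List.prod_nil, hl,
      hx]
    simp
  have key : ∀ i j, i ≤ j → j ≤ l.length →
      d (x * (l.take i).prod) (x * (l.take j).prod) = (j : ℝ) - i := by
    intro i j hij hj
    have h1 := upper 0 i (by omega) (by omega)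
    have h2 := upper i j hij hj
    have h3 := upper j l.length hj le_rfl
    have h4 := d.triangle (x * (l.take 0).prod) (x * (l.take i).prod) (x * (l.take j).prod)
    have h5 := d.triangle (x * (l.take 0).prod) (x * (l.take j).prod) (x * (l.take l.length).prod)
    push_cast at h1
    linarith
  intro i hi j hj
  change d _ _ = _
  rcases le_total i j with h | h
  · rw [key i j h hj, abs_sub_comm, abs_of_nonneg (by simpa using h)]
  · rw [d.symm, key j i h hi, abs_of_nonneg (by simpa using h)]

/-- For `d₀ ∈ 𝒟_Γ` and any finite symmetric generating set `S`, the `d_S`-geodesics are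
uniform quasi-geodesics of `d₀`. -/
theorem exists_isQuasiGeodesic_of_mem_metricSpaceD {d₀ : PseudoMetric Γ ℝ}
    (h : d₀ ∈ metricSpaceD Γ) {S : Set Γ} (hS : IsFiniteSymmGen S) :
    ∃ K L A : ℝ, 0 < K ∧ 0 < L ∧ (∀ x y, d₀ x y ≤ K * wordDist S x y) ∧
      (∀ x y, wordDist S x y ≤ L * d₀ x y + A) ∧
      ∀ (f : ℕ → Γ) (n : ℕ),
        (∀ i ≤ n, ∀ j ≤ n, wordDist S (f i) (f j) = |(i : ℝ) - (j : ℝ)|) →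
        IsQuasiGeodesic d₀ K L A f n := by
  obtain ⟨hinv, -, S₁, hS₁, L, C, hL, hC, hLC⟩ := h
  obtain ⟨K, hK, hKd⟩ := hinv.exists_le_wordDist hS
  obtain ⟨M, hM, hMd⟩ := (isLeftInvariant_wordPseudoMetric hS).exists_le_wordDist hS₁
  have lower : ∀ x y, wordDist S x y ≤ (M * L) * d₀ x y + M * L * C := by
    intro x y
    have h1 := hMd x y
    rw [wordPseudoMetric_apply] at h1
    have h2 : wordDist S₁ x y ≤ L * (d₀ x y + C) := by
      have := (hLC x y).1
      rw [← inv_mul_le_iff₀ hL]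
      linarith
    calc wordDist S x y ≤ M * wordDist S₁ x y := h1
      _ ≤ M * (L * (d₀ x y + C)) := by gcongr
      _ = _ := by ring
  refine ⟨K, M * L, M * L * C, hK, by positivity, hKd, lower, fun f n hf => ⟨?_, ?_⟩⟩
  · intro i hi
    have := hKd (f i) (f (i + 1))
    rw [hf i hi.le (i + 1) hi] at this
    simpa using this
  · intro i hi j hj
    rw [← hf i hi j hj]
    exact lower _ _

theorem IsLeftInvariant.gromovProduct_mul {d : PseudoMetric Γ ℝ} (hd : IsLeftInvariant d)
    (h z x y : Γ) : gromovProduct d (h * z) (h * x) (h * y) = gromovProduct d z x y := by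
  simp [gromovProduct, hd h]

/-- Stability of word geodesics with respect to any pseudo metric in `𝒟_Γ`. -/
theorem exists_gromovProduct_le_of_wordGeodesic {d₀ : PseudoMetric Γ ℝ}
    (h : d₀ ∈ metricSpaceD Γ) {S : Set Γ} (hS : IsFiniteSymmGen S) :
    ∃ C, 0 ≤ C ∧ ∀ (f : ℕ → Γ) (n : ℕ),
        (∀ i ≤ n, ∀ j ≤ n, wordDist S (f i) (f j) = |(i : ℝ) - (j : ℝ)|) →
        ∀ i ≤ n, gromovProduct d₀ (f i) (f 0) (f n) ≤ C := by
  obtain ⟨δ, hδ, hyp⟩ := h.2.1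
  obtain ⟨K, L, A, hK, hL, -, -, hq⟩ := exists_isQuasiGeodesic_of_mem_metricSpaceD h hS
  obtain ⟨C, hC, H⟩ := exists_gromovProduct_le_of_isQuasiGeodesic (A := A) hδ hK.le hL hyp
  exact ⟨C, hC, fun f n hf => H f n (hq f n hf)⟩

/-- A word geodesic from `x` to `y` passes near the identity at distance about `(x|y)`. -/
theorem exists_wordLength_le_gromovProduct {d₀ : PseudoMetric Γ ℝ}
    (h : d₀ ∈ metricSpaceD Γ) {S : Set Γ} (hS : IsFiniteSymmGen S) :
    ∃ L C : ℝ, 0 < L ∧ 0 ≤ C ∧ ∀ (f : ℕ → Γ) (n : ℕ),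
        (∀ i ≤ n, ∀ j ≤ n, wordDist S (f i) (f j) = |(i : ℝ) - (j : ℝ)|) →
        ∃ i ≤ n, wordDist S 1 (f i) ≤ L * gromovProduct d₀ 1 (f 0) (f n) + C := by
  obtain ⟨δ, hδ, hyp⟩ := h.2.1
  obtain ⟨K, L, A, hK, hL, -, hLA, hq⟩ := exists_isQuasiGeodesic_of_mem_metricSpaceD h hS
  obtain ⟨C, hC, H⟩ := exists_gromovProduct_le_of_wordGeodesic h hS
  refine ⟨L, max 0 (L * (4 * K + 2 * δ + C) + A), hL, le_max_left _ _, fun f n hf => ?_⟩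
  -- A discrete intermediate value argument finds `i` where the two products agree up to `K`. By
  -- hyperbolicity the smaller is at most (f 0|f n) + δ, so both are controlled, and `h3` expresses
  -- `d₀ 1 (f i)` through them.
  set u : ℕ → ℝ := fun i => gromovProduct d₀ 1 (f 0) (f i) - gromovProduct d₀ 1 (f n) (f i) with hu
  have step : ∀ i < n, u i - u (i + 1) ≤ K := by
    intro i hi
    have h1 := (hq f n hf).step i hi
    have h2 := d₀.triangle (f 0) (f i) (f (i + 1))
    have h3 := d₀.triangle (f n) (f (i + 1)) (f i)
    rw [d₀.symm (f (i + 1)) (f i)] at h3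
    simp only [hu, gromovProduct]
    linarith
  have start : 0 ≤ u 0 := by
    have := gromovProduct_le_right d₀ 1 (f n) (f 0)
    simp only [hu, gromovProduct, d₀.refl] at this ⊢
    linarith [d₀.symm 1 (f 0)]
  have finish : u n ≤ 0 := by
    have := gromovProduct_le_right d₀ 1 (f 0) (f n)
    simp only [hu, gromovProduct, d₀.refl] at this ⊢
    linarith [d₀.symm 1 (f n)]
  obtain ⟨i, hi, hi1, hi2⟩ : ∃ i ≤ n, -K ≤ u i ∧ u i ≤ 0 := by
    classical
    have hex : ∃ i, u i ≤ 0 := ⟨n, finish⟩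
    have hle : Nat.find hex ≤ n := Nat.find_min' hex finish
    refine ⟨Nat.find hex, hle, ?_, Nat.find_spec hex⟩
    rcases Nat.eq_zero_or_pos (Nat.find hex) with h0 | h0
    · rw [h0]; linarith
    · have h1 := Nat.find_min hex (Nat.sub_lt h0 one_pos)
      have h2 := step (Nat.find hex - 1) (by omega)
      rw [Nat.sub_add_cancel h0] at h2
      linarith
  refine ⟨i, hi, ?_⟩
  have h1 := H f n hf i hi
  have h2 := hyp (f 0) (f n) 1 (f i)
  have h3 : d₀ 1 (f i) = gromovProduct d₀ 1 (f 0) (f i) + gromovProduct d₀ 1 (f n) (f i)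
      - gromovProduct d₀ 1 (f 0) (f n) + gromovProduct d₀ (f i) (f 0) (f n) := by
    simp only [gromovProduct]
    linarith [d₀.symm (f n) (f i), d₀.symm 1 (f n)]
  have h4 : d₀ 1 (f i) ≤ gromovProduct d₀ 1 (f 0) (f n) + (4 * K + 2 * δ + C) := by
    simp only [hu] at hi1 hi2
    rcases min_le_iff.1 (sub_le_iff_le_add.1 h2) with h5 | h5 <;> linarith
  refine (hLA 1 (f i)).trans ?_
  have : L * d₀ 1 (f i) ≤ L * (gromovProduct d₀ 1 (f 0) (f n) + (4 * K + 2 * δ + C)) := by gcongr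
  linarith [le_max_right 0 (L * (4 * K + 2 * δ + C) + A)]

end Word

/-! ### Groups acting on rooted trees with finite stabilizers -/

section Equivariant

/-- A free finite action is classified by its number of orbits, which is the cardinality divided by
that of `G`. Orbits are matched arbitrarily, and representatives are sent to representatives. -/
theorem exists_equivariant_equiv {G X₁ X₂ : Type*} [Group G] [MulAction G X₁] [MulAction G X₂]
    [Finite X₁] [Finite X₂] (h₁ : ∀ (g : G) (x : X₁), g • x = x → g = 1)
    (h₂ : ∀ (g : G) (x : X₂), g • x = x → g = 1) (hc : Nat.card X₁ = Nat.card X₂) :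
    ∃ e : X₁ ≃ X₂, ∀ (g : G) (x : X₁), e (g • x) = g • e x := by
  classical
  rcases isEmpty_or_nonempty X₁ with hX | ⟨⟨x₀⟩⟩
  · have : IsEmpty X₂ := by
      rw [← Finite.card_eq_zero_iff, ← hc, Finite.card_eq_zero_iff]
      exact hX
    exact ⟨Equiv.equivOfIsEmpty _ _, fun g x => hX.elim x⟩
  have inj : Function.Injective fun g : G => g • x₀ := by
    intro a b hab
    have : (b⁻¹ * a) • x₀ = x₀ := by
      simp only at hab
      rw [mul_smul, hab, inv_smul_smul]
    rw [← inv_mul_eq_one, ← inv_inj]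
    simpa using h₁ _ _ this
  have : Finite G := Finite.of_injective _ inj
  have s₁ : ∀ x : X₁, MulAction.stabilizer G x = ⊥ := fun x =>
    (Subgroup.eq_bot_iff_forall _).2 fun g hg => h₁ g x hg
  have s₂ : ∀ x : X₂, MulAction.stabilizer G x = ⊥ := fun x =>
    (Subgroup.eq_bot_iff_forall _).2 fun g hg => h₂ g x hg
  have c₁ := Nat.card_congr (MulAction.selfEquivOrbitsQuotientProd s₁)
  have c₂ := Nat.card_congr (MulAction.selfEquivOrbitsQuotientProd s₂)
  rw [Nat.card_prod] at c₁ c₂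
  have hq : Nat.card (Quotient (MulAction.orbitRel G X₁)) =
      Nat.card (Quotient (MulAction.orbitRel G X₂)) :=
    Nat.eq_of_mul_eq_mul_right Nat.card_pos (c₁.symm.trans (hc.trans c₂))
  obtain ⟨q⟩ := Finite.card_eq.1 hq
  have hrep : ∀ x : X₁, ∃ g : G, g • (Quotient.mk (MulAction.orbitRel G X₁) x).out = x := fun x =>
    MulAction.orbitRel_apply.1 (Quotient.exact (Quotient.out_eq _).symm)
  choose γ hγ using hrep
  set φ : X₁ → X₂ := fun x => γ x • (q (Quotient.mk _ x)).out with hφ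
  have equi : ∀ (g : G) (x : X₁), φ (g • x) = g • φ x := by
    intro g x
    have hmk : Quotient.mk (MulAction.orbitRel G X₁) (g • x) = Quotient.mk _ x :=
      Quotient.sound (MulAction.orbitRel_apply.2 ⟨g, rfl⟩)
    have h3 := hγ (g • x)
    rw [hmk] at h3
    have h4 : γ (g • x) = g * γ x := by
      have : ((g * γ x)⁻¹ * γ (g • x)) • (Quotient.mk (MulAction.orbitRel G X₁) x).out =
          (Quotient.mk (MulAction.orbitRel G X₁) x).out := by
        rw [mul_smul, h3, inv_smul_eq_iff, mul_smul, hγ x]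
      exact (inv_mul_eq_one.1 (h₁ _ _ this)).symm
    simp only [hφ]
    rw [hmk, h4, mul_smul]
  have hinj : Function.Injective φ := by
    intro x y hxy
    have e1 : ∀ z, Quotient.mk (MulAction.orbitRel G X₂) (φ z) = q (Quotient.mk _ z) := by
      intro z
      conv_rhs => rw [← Quotient.out_eq (q (Quotient.mk _ z))]
      exact Quotient.sound (MulAction.orbitRel_apply.2 ⟨γ z, rfl⟩)
    have e2 := e1 x
    rw [hxy, e1 y] at e2
    obtain ⟨g, rfl⟩ := MulAction.orbitRel_apply.1 (Quotient.exact (q.injective e2))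
    simp only at hxy ⊢
    rw [equi] at hxy
    rw [h₂ g _ hxy.symm]
    exact (one_smul _ _).symm
  exact ⟨Equiv.ofBijective φ (hinj.bijective_of_nat_card_le hc.ge), equi⟩

/-- The stabilizer of `p` acts freely on `A p` and `B p`, so a stabilizer-equivariant bijection
exists. Choosing one per orbit of `P` and translating is consistent exactly because of that
equivariance. -/
theorem exists_equivariant_bijOn {G P Y : Type*} [Group G] [MulAction G P] [MulAction G Y]
    (hfree : ∀ (g : G) (y : Y), g • y = y → g = 1) (A B : P → Set Y)
    (hA : ∀ (g : G) p y, y ∈ A p → g • y ∈ A (g • p))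
    (hB : ∀ (g : G) p y, y ∈ B p → g • y ∈ B (g • p))
    (hAf : ∀ p, (A p).Finite) (hBf : ∀ p, (B p).Finite)
    (hcard : ∀ p, (A p).ncard = (B p).ncard) :
    ∃ ψ : P → Y → Y, (∀ p, Set.BijOn (ψ p) (A p) (B p)) ∧
      ∀ (g : G) p y, y ∈ A p → ψ (g • p) (g • y) = g • ψ p y := by
  classical
  have loc : ∀ p, ∃ θ : Y → Y, Set.BijOn θ (A p) (B p) ∧
      ∀ k : G, k • p = p → ∀ y ∈ A p, θ (k • y) = k • θ y := by
    intro p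
    let A' : SubMulAction (MulAction.stabilizer G p) Y :=
      ⟨A p, fun k {y} hy => by
        have := hA k p y hy
        rwa [k.2] at this⟩
    let B' : SubMulAction (MulAction.stabilizer G p) Y :=
      ⟨B p, fun k {y} hy => by
        have := hB k p y hy
        rwa [k.2] at this⟩
    have : Finite A' := (hAf p).to_subtype
    have : Finite B' := (hBf p).to_subtype
    obtain ⟨e, he⟩ := exists_equivariant_equiv (G := MulAction.stabilizer G p) (X₁ := A') (X₂ := B')
      (fun g x h => Subtype.ext (hfree g x (congrArg Subtype.val h)))
      (fun g x h => Subtype.ext (hfree g x (congrArg Subtype.val h))) (hcard p)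
    refine ⟨fun y => if h : y ∈ A p then (e ⟨y, h⟩ : Y) else y, ⟨?_, ?_, ?_⟩, ?_⟩
    · intro y hy
      simp only [hy, dite_true]
      exact (e ⟨y, hy⟩).2
    · intro y hy z hz h
      simp only [hy, hz, dite_true] at h
      exact congrArg Subtype.val (e.injective (Subtype.ext h))
    · intro z hz
      obtain ⟨⟨y, hy⟩, h⟩ := e.surjective ⟨z, hz⟩
      refine ⟨y, hy, ?_⟩
      have hy' : y ∈ A p := hy
      simp only [hy', dite_true]
      exact congrArg Subtype.val h
    · intro k hk y hy
      have h1 : k • y ∈ A p := by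
        have := hA k p y hy
        rwa [hk] at this
      simp only [hy, h1, dite_true]
      exact congrArg Subtype.val (he ⟨k, hk⟩ ⟨y, hy⟩)
  choose θ hθ hθ' using loc
  have hrep : ∀ p : P, ∃ g : G, g • (Quotient.mk (MulAction.orbitRel G P) p).out = p := fun x =>
    MulAction.orbitRel_apply.1 (Quotient.exact (Quotient.out_eq _).symm)
  choose γ hγ using hrep
  set ρ : P → P := fun p => (Quotient.mk (MulAction.orbitRel G P) p).out with hρ
  have hγ' : ∀ p, (γ p)⁻¹ • p = ρ p := fun p => by rw [inv_smul_eq_iff]; exact (hγ p).symm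
  have memA : ∀ p y, y ∈ A p → (γ p)⁻¹ • y ∈ A (ρ p) := fun p y hy => by
    have := hA (γ p)⁻¹ p y hy
    rwa [hγ'] at this
  refine ⟨fun p y => γ p • θ (ρ p) ((γ p)⁻¹ • y), fun p => ⟨?_, ?_, ?_⟩, ?_⟩
  · intro y hy
    have := hB (γ p) _ _ ((hθ (ρ p)).mapsTo (memA p y hy))
    rwa [hγ p] at this
  · intro y hy z hz h
    exact MulAction.injective _ ((hθ (ρ p)).injOn (memA p y hy) (memA p z hz)
      (MulAction.injective _ h))
  · intro z hz
    have h1 := hB (γ p)⁻¹ p z hz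
    rw [hγ'] at h1
    obtain ⟨y, hy, h2⟩ := (hθ (ρ p)).surjOn h1
    have h3 := hA (γ p) _ _ hy
    rw [hγ p] at h3
    exact ⟨γ p • y, h3, by simp only [inv_smul_smul, h2, smul_inv_smul]⟩
  · intro g p y hy
    have hmk : ρ (g • p) = ρ p := congrArg Quotient.out
      (Quotient.sound (MulAction.orbitRel_apply.2 ⟨g, rfl⟩))
    simp only
    rw [hmk]
    have hk : ((γ (g • p))⁻¹ * g * γ p) • ρ p = ρ p := by
      rw [mul_smul, mul_smul, show γ p • ρ p = p from hγ p, hγ', hmk]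
    have h1 := hθ' (ρ p) _ hk _ (memA p y hy)
    rw [← mul_smul] at h1
    rw [← mul_smul, show (γ (g • p))⁻¹ * g = (γ (g • p))⁻¹ * g * γ p * (γ p)⁻¹ by group, h1,
      ← mul_smul, ← mul_smul]
    congr 1
    group

end Equivariant

/-- A rooted tree structure on a set of vertices, given by the parent function. -/
structure RootedTree (V : Type*) where
  root : V
  parent : V → V
  rank : V → ℕ
  rank_parent_lt : ∀ v, v ≠ root → rank (parent v) < rank v

namespace RootedTree

variable {V : Type*} (τ : RootedTree V)

/-- Adjacency in a rooted tree. -/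
def Adj (v w : V) : Prop :=
  (w ≠ τ.root ∧ τ.parent w = v) ∨ (v ≠ τ.root ∧ τ.parent v = w)

theorem adj_parent {v : V} (h : v ≠ τ.root) : τ.Adj (τ.parent v) v := Or.inl ⟨h, rfl⟩

theorem Adj.ne {τ : RootedTree V} {v w : V} (h : τ.Adj v w) : v ≠ w := by
  rintro rfl
  have h' : v ≠ τ.root ∧ τ.parent v = v := h.elim id id
  have := τ.rank_parent_lt v h'.1
  rw [h'.2] at this
  exact lt_irrefl _ this

theorem induction {P : V → Prop} (h0 : P τ.root)
    (h1 : ∀ v, v ≠ τ.root → P (τ.parent v) → P v) (v : V) : P v := by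
  induction hn : τ.rank v using Nat.strong_induction_on generalizing v with
  | _ n ih =>
    by_cases hv : v = τ.root
    · exact hv ▸ h0
    · exact h1 v hv (ih _ (hn ▸ τ.rank_parent_lt v hv) _ rfl)

open Classical in
/-- Recursive extension of a section from the root along the tree. -/
def extend {F : V → Type*} (y : F τ.root) (e : ∀ v, v ≠ τ.root → F (τ.parent v) → F v) (v : V) :
    F v :=
  if h : v = τ.root then h ▸ y else e v h (extend y e (τ.parent v))
termination_by τ.rank v
decreasing_by exact τ.rank_parent_lt v h

theorem exists_section {Y : Type*} (A : V → Set Y) (R : V → V → Y → Y → Prop)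
    (hsymm : ∀ v w y z, R v w y z → R w v z y) (h0 : (A τ.root).Nonempty)
    (hext : ∀ v, v ≠ τ.root → ∀ y ∈ A (τ.parent v), ∃ z ∈ A v, R (τ.parent v) v y z) :
    ∃ s : V → Y, (∀ v, s v ∈ A v) ∧ ∀ v w, τ.Adj v w → R v w (s v) (s w) := by
  obtain ⟨y, hy⟩ := h0
  choose! e he hR using hext
  let s : ∀ v, A v := τ.extend (F := fun v => A v) ⟨y, hy⟩
    fun v hv z => ⟨e v z, he v hv z z.2⟩
  have hs : ∀ v, v ≠ τ.root → (s v : Y) = e v (s (τ.parent v)) := by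
    intro v hv
    simp only [s]
    rw [extend, dif_neg hv]
  have key : ∀ v, v ≠ τ.root → R (τ.parent v) v (s (τ.parent v)) (s v) := fun v hv => by
    rw [hs v hv]
    exact hR v hv _ (s _).2
  refine ⟨fun v => s v, fun v => (s v).2, ?_⟩
  rintro v w (⟨hw, rfl⟩ | ⟨hv, rfl⟩)
  · exact key w hw
  · exact hsymm _ _ _ _ (key v hv)

/-- A group acting freely and without inversions on a tree is free. -/
theorem isFreeGroup_of_free_action {G : Type*} [Group G] [MulAction G V]
    (hinv : ∀ (g : G) v w, τ.Adj v w → τ.Adj (g • v) (g • w))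
    (hfree : ∀ (g : G) (v : V), g • v = v → g = 1)
    (hninv : ∀ (g : G) v w, τ.Adj v w → g • v = w → g • w = v → False) : IsFreeGroup G := by
  classical
  let O := Quotient (MulAction.orbitRel G (V × V))
  let c : V → V → O := fun v w => Quotient.mk _ (v, w)
  have hc : ∀ (g : G) v w, c (g • v) (g • w) = c v w := fun g v w =>
    Quotient.sound (MulAction.orbitRel_apply.2 ⟨g, rfl⟩)
  have hc' : ∀ v w v' w', c v w = c v' w' → ∃ g : G, g • v' = v ∧ g • w' = w := by
    intro v w v' w' h
    obtain ⟨g, hg⟩ := MulAction.orbitRel_apply.1 (Quotient.exact h)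
    exact ⟨g, congrArg Prod.fst hg, congrArg Prod.snd hg⟩
  -- Using both orientations of an edge makes `lab w v` inverse to `lab v w` without choosing
  -- orientations. `F v` is the product of labels along the path from the root.
  let lab : V → V → FreeGroup O := fun v w => FreeGroup.of (c v w) * (FreeGroup.of (c w v))⁻¹
  obtain ⟨F, hFA, hF⟩ := τ.exists_section (Y := FreeGroup O)
    (fun v => {x | v = τ.root → x = 1}) (fun v w y z => z = y * lab v w)
    (fun v w y z h => by rw [h]; simp [lab, mul_assoc]) ⟨1, fun _ => rfl⟩
    (fun v hv y _ => ⟨_, fun h => absurd h hv, rfl⟩)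
  have F0 : F τ.root = 1 := hFA τ.root rfl
  have word : ∀ v, ∃ l, FreeGroup.IsReduced l ∧ F v = FreeGroup.mk l ∧
      (v = τ.root → l = []) ∧ (v ≠ τ.root → ∃ l',
        l = l' ++ [(c (τ.parent v) v, true), (c v (τ.parent v), false)]) := by
    refine τ.induction ⟨[], FreeGroup.IsReduced.nil, F0, fun _ => rfl, fun h => absurd rfl h⟩ ?_
    intro v hv ⟨l, hl, hFl, hl0, hl1⟩
    refine ⟨l ++ [(c (τ.parent v) v, true), (c v (τ.parent v), false)], ?_, ?_,
      fun h => absurd h hv, fun _ => ⟨l, rfl⟩⟩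
    -- The word stays reduced: cancellation inside a label would be an inversion; cancellation
    -- between consecutive labels would give an element fixing `τ.parent v` and moving `v` to its
    -- grandparent.
    · have h2 : c (τ.parent v) v ≠ c v (τ.parent v) := by
        intro h
        obtain ⟨g, hg1, hg2⟩ := hc' _ _ _ _ h
        exact hninv g _ _ (τ.adj_parent hv) hg2 hg1
      refine List.isChain_append.2 ⟨hl, ?_, ?_⟩
      · simp [h2]
      · intro x hx y hy
        by_cases hp : τ.parent v = τ.root
        · simp [hl0 hp] at hx
        · obtain ⟨l', rfl⟩ := hl1 hp
          simp only [List.getLast?_append, List.getLast?_cons_cons, List.getLast?_singleton,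
            Option.some_or, Option.mem_def, Option.some.injEq] at hx
          simp only [List.head?_cons, Option.mem_def, Option.some.injEq] at hy
          subst hx hy
          intro h
          obtain ⟨g, hg1, hg2⟩ := hc' _ _ _ _ h
          rw [hfree g _ hg1, one_smul] at hg2
          have r1 := τ.rank_parent_lt v hv
          have r2 := τ.rank_parent_lt _ hp
          rw [← hg2] at r2
          omega
    · rw [hF _ _ (τ.adj_parent hv), hFl]
      simp [lab, FreeGroup.of, FreeGroup.mul_mk, FreeGroup.inv_mk, FreeGroup.invRev]
  have transl : ∀ (g : G) v, F (g • v) = F (g • τ.root) * F v := by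
    intro g
    refine τ.induction (by simp [F0]) ?_
    intro v hv ih
    rw [hF _ _ (hinv g _ _ (τ.adj_parent hv)), ih, hF _ _ (τ.adj_parent hv), mul_assoc]
    simp only [lab, hc]
  let ρ : G →* FreeGroup O :=
    { toFun := fun g => F (g • τ.root)
      map_one' := by simp [F0]
      map_mul' := fun g h => by rw [mul_smul, transl g] }
  have hρ : Function.Injective ρ := by
    rw [injective_iff_map_eq_one]
    intro g hg
    obtain ⟨l, hl, hFl, -, hl1⟩ := word (g • τ.root)
    have h1 : FreeGroup.mk l = 1 := hFl.symm.trans hg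
    have h2 : l = [] := by
      rw [← hl.reduce_eq, ← FreeGroup.toWord_mk, h1, FreeGroup.toWord_one]
    refine hfree g τ.root (not_not.1 fun h => ?_)
    obtain ⟨l', hl'⟩ := hl1 h
    simp [hl'] at h2
  -- Nielsen–Schreier: the embedded copy of `G` is a subgroup of a free group.
  obtain ⟨ι, ⟨b⟩⟩ := (inferInstance : IsFreeGroup ρ.range).nonempty_basis
  exact (b.map (MonoidHom.ofInjective hρ).symm).isFreeGroup

end RootedTree

/-- The elements of `B`, each with one of `N / |B|` colours: a set of `N` elements when `|B|`
divides `N`. -/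
def coloring {G : Type*} (N : ℕ) (B : Set G) : Set (Σ _ : ℕ, G) :=
  (fun p : ℕ × G => ⟨p.1, p.2⟩) '' (Set.Iio (N / B.ncard) ×ˢ B)

theorem mem_coloring {G : Type*} {N : ℕ} {B : Set G} {y : Σ _ : ℕ, G} :
    y ∈ coloring N B ↔ y.1 < N / B.ncard ∧ y.2 ∈ B := by
  constructor
  · rintro ⟨p, ⟨h1, h2⟩, rfl⟩
    exact ⟨h1, h2⟩
  · intro ⟨h1, h2⟩
    exact ⟨(y.1, y.2), ⟨h1, h2⟩, rfl⟩

theorem finite_coloring {G : Type*} (N : ℕ) {B : Set G} (hB : B.Finite) : (coloring N B).Finite :=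
  ((Set.finite_Iio _).prod hB).image _

theorem ncard_coloring {G : Type*} {N : ℕ} {B : Set G} (hN : B.ncard ∣ N) :
    (coloring N B).ncard = N := by
  unfold coloring
  rw [Set.ncard_image_of_injective, Set.ncard_prod, Set.ncard_Iio_nat, Nat.div_mul_cancel hN]
  rintro ⟨a, b⟩ ⟨a', b'⟩ h
  simpa using h

namespace RootedTree

variable {V : Type*} (τ : RootedTree V)

/-- Vertices and edges get fibres of the same size `N`, and equivariant bijections from vertex
fibres to edge fibres form an invariant connection. A flat section is determined by its value at the
root, so a section `s` has finitely many translates, and its stabilizer `H` has finite index. Since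
`G` acts freely on fibre elements, an element of `H` fixing a vertex is trivial. -/
theorem exists_finiteIndex_free_action {G : Type*} [Group G] [MulAction G V]
    (hinv : ∀ (g : G) v w, τ.Adj v w → τ.Adj (g • v) (g • w)) (B : V → Set G)
    (hB : ∀ (g : G) v, B (g • v) = (fun a => g * a) '' B v) (hne : ∀ v, (B v).Nonempty)
    (hfin : ∀ v, (B v).Finite) (M : ℕ) (hM : ∀ v, (B v).ncard ≤ M) :
    ∃ H : Subgroup G, H.FiniteIndex ∧ (∀ g ∈ H, ∀ v : V, g • v = v → g = 1) ∧
      ∀ g ∈ H, ∀ v w, τ.Adj v w → g • v = w → g • w = v → False := by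
  classical
  -- Divisible by every possible size of a vertex family (at most `M`) or of a union of two (at most
  -- `2 * M`).
  set N := (2 * M).factorial with hN
  let E : V × V → Set G := fun e => B e.1 ∪ B e.2
  have hE : ∀ (g : G) e, E (g • e) = (fun a => g * a) '' E e := fun g e => by
    simp only [E, Prod.smul_fst, Prod.smul_snd, hB, Set.image_union]
  have dvd : ∀ C : Set G, C.Nonempty → C.Finite → C.ncard ≤ 2 * M → C.ncard ∣ N :=
    fun C h1 h2 h3 => Nat.dvd_factorial ((Set.ncard_pos h2).2 h1) h3
  have cardB : ∀ v, (coloring N (B v)).ncard = N := fun v =>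
    ncard_coloring (dvd _ (hne v) (hfin v) (by linarith [hM v]))
  have cardE : ∀ e, (coloring N (E e)).ncard = N := fun e =>
    ncard_coloring (dvd _ ((hne e.1).mono Set.subset_union_left) ((hfin e.1).union (hfin e.2))
      ((Set.ncard_union_le _ _).trans (by linarith [hM e.1, hM e.2])))
  have act : ∀ (C : Set G) (g : G) (y : Σ _ : ℕ, G), y ∈ coloring N C →
      g • y ∈ coloring N ((fun a => g * a) '' C) := by
    intro C g y hy
    rw [mem_coloring] at hy ⊢
    rw [Set.ncard_image_of_injective _ (mul_right_injective g)]
    exact ⟨hy.1, y.2, hy.2, rfl⟩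
  have yfree : ∀ (g : G) (y : Σ _ : ℕ, G), g • y = y → g = 1 := by
    rintro g ⟨i, a⟩ h
    rw [Sigma.smul_mk] at h
    simpa using h
  obtain ⟨ψ, hψ, hψ'⟩ := exists_equivariant_bijOn (G := G) (P := V × V) yfree
    (fun e => coloring N (B e.1)) (fun e => coloring N (E e))
    (fun g p y hy => by
      rw [Prod.smul_fst, hB]
      exact act _ g y hy)
    (fun g p y hy => by
      rw [hE]
      exact act _ g y hy)
    (fun e => finite_coloring N (hfin _)) (fun e => finite_coloring N ((hfin _).union (hfin _)))
    (fun e => (cardB _).trans (cardE _).symm)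
  have Esymm : ∀ v w, E (v, w) = E (w, v) := fun v w => Set.union_comm _ _
  obtain ⟨s, hs, hflat⟩ := τ.exists_section (fun v => coloring N (B v))
    (fun v w y z => ψ (v, w) y = ψ (w, v) z) (fun v w y z h => h.symm)
    (Set.nonempty_of_ncard_ne_zero (by rw [cardB]; exact (Nat.factorial_pos _).ne'))
    (fun v hv y hy => by
      have h1 := (hψ (τ.parent v, v)).mapsTo hy
      rw [Esymm] at h1
      obtain ⟨z, hz, h⟩ := (hψ (v, τ.parent v)).surjOn h1
      exact ⟨z, hz, h.symm⟩)
  have smem : ∀ (g : G) v, g • s v ∈ coloring N (B (g • v)) := fun g v => by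
    rw [hB]
    exact act _ _ _ (hs v)
  have uniq : ∀ g h : G, g • s (g⁻¹ • τ.root) = h • s (h⁻¹ • τ.root) →
      ∀ v, g • s (g⁻¹ • v) = h • s (h⁻¹ • v) := by
    intro g h h0
    refine τ.induction h0 ?_
    intro v hv ih
    have flat : ∀ g : G, ψ (τ.parent v, v) (g • s (g⁻¹ • τ.parent v)) =
        ψ (v, τ.parent v) (g • s (g⁻¹ • v)) := by
      intro g
      have h1 := hflat _ _ (hinv g⁻¹ _ _ (τ.adj_parent hv))
      have h2 := hψ' g (g⁻¹ • τ.parent v, g⁻¹ • v) _ (hs _)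
      have h3 := hψ' g (g⁻¹ • v, g⁻¹ • τ.parent v) _ (hs _)
      rw [Prod.smul_mk, smul_inv_smul, smul_inv_smul] at h2 h3
      rw [h2, h3, h1]
    have mem : ∀ g : G, g • s (g⁻¹ • v) ∈ coloring N (B v) := fun g => by
      have := smem g (g⁻¹ • v)
      rwa [smul_inv_smul] at this
    refine (hψ (v, τ.parent v)).injOn (mem g) (mem h) ?_
    rw [← flat, ← flat, ih]
  let H : Subgroup G :=
    { carrier := {g | ∀ v, s (g • v) = g • s v}
      one_mem' := fun v => by simp
      mul_mem' := fun {a b} ha hb v => by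
        rw [mul_smul, ha, hb, mul_smul]
      inv_mem' := fun {a} ha v => by
        rw [eq_inv_smul_iff, ← ha, smul_inv_smul] }
  refine ⟨H, ?_, ?_, ?_⟩
  · have : Finite (coloring N (B τ.root)) := (finite_coloring N (hfin _)).to_subtype
    let φ : G ⧸ H → coloring N (B τ.root) := fun q => ⟨q.out • s (q.out⁻¹ • τ.root), by
      have := smem q.out (q.out⁻¹ • τ.root)
      rwa [smul_inv_smul] at this⟩
    have hφ : Function.Injective φ := by
      intro q q' h
      have h1 := uniq _ _ (congrArg Subtype.val h)
      have h2 : q.out⁻¹ * q'.out ∈ H := by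
        intro v
        have h3 := h1 (q'.out • v)
        rw [inv_smul_smul] at h3
        rw [mul_smul, mul_smul, ← h3, inv_smul_smul]
      rw [← QuotientGroup.out_eq' q, ← QuotientGroup.out_eq' q']
      exact QuotientGroup.eq.2 h2
    have : Finite (G ⧸ H) := Finite.of_injective φ hφ
    exact Subgroup.finiteIndex_of_finite_quotient
  · intro g hg v hv
    have h1 := hg v
    rw [hv] at h1
    exact yfree g _ h1.symm
  -- An inversion in `H` would fix the common image of `s v` and `s w` in the edge fibre, hence be
  -- trivial.
  · intro g hg v w hvw h1 h2
    refine hvw.ne ?_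
    have h3 := hflat v w hvw
    have h4 := hψ' g (v, w) _ (hs v)
    rw [Prod.smul_mk, h1, h2, ← hg v, h1, ← h3] at h4
    rw [← h1, yfree g _ h4.symm, one_smul]

/-- A group acting on a tree with uniformly finite equivariant families of group elements attached
to the vertices is virtually free. -/
theorem isVirtuallyFree {G : Type*} [Group G] [MulAction G V]
    (hinv : ∀ (g : G) v w, τ.Adj v w → τ.Adj (g • v) (g • w)) (B : V → Set G)
    (hB : ∀ (g : G) v, B (g • v) = (fun a => g * a) '' B v) (hne : ∀ v, (B v).Nonempty)
    (hfin : ∀ v, (B v).Finite) (M : ℕ) (hM : ∀ v, (B v).ncard ≤ M) : IsVirtuallyFree G := by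
  obtain ⟨H, hH, h1, h2⟩ := τ.exists_finiteIndex_free_action hinv B hB hne hfin M hM
  exact ⟨H, hH, τ.isFreeGroup_of_free_action (G := H) (fun g => hinv g)
    (fun g v h => Subtype.ext (h1 g g.2 v h)) (fun g => h2 g g.2)⟩

end RootedTree

/-! ### Geometry of `ℝ`-trees -/

section RTree

variable {T : Type*} [MetricSpace T]

/-- `m` lies between `x` and `y`. -/
def Between (x m y : T) : Prop := dist x m + dist m y = dist x y

theorem Between.symm {x m y : T} (h : Between x m y) : Between y m x := by
  unfold Between at *
  rw [dist_comm y m, dist_comm m x, dist_comm y x, ← h, add_comm]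

theorem between_left (x y : T) : Between x x y := by simp [Between]

theorem between_right (x y : T) : Between x y y := by simp [Between]

theorem Between.eq_of_self {x m : T} (h : Between x m x) : m = x := by
  unfold Between at h
  rw [dist_comm m x, dist_self] at h
  exact (dist_eq_zero.1 (by linarith)).symm

theorem Between.smul {Γ : Type*} [Group Γ] [MulAction Γ T] [IsIsometricSMul Γ T] {x m y : T}
    (h : Between x m y) (g : Γ) : Between (g • x) (g • m) (g • y) := by
  unfold Between at *
  simpa only [dist_smul] using h

theorem between_smul_iff {Γ : Type*} [Group Γ] [MulAction Γ T] [IsIsometricSMul Γ T] {x m y : T}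
    (g : Γ) : Between (g • x) (g • m) (g • y) ↔ Between x m y := by
  simp only [Between, dist_smul]

theorem IsRTree.fourPoint (hT : IsRTree T) (x y z w : T) :
    dist x y + dist z w ≤ max (dist x w + dist z y) (dist y w + dist z x) := by
  have := IsDeltaHyperbolic.fourPoint
    (d := ⟨fun x y => dist x y, dist_self, dist_comm, dist_triangle⟩) hT.2 x y z w
  simpa using this

theorem IsRTree.exists_between (hT : IsRTree T) (x y : T) {t : ℝ} (h0 : 0 ≤ t)
    (h1 : t ≤ dist x y) : ∃ m, dist x m = t ∧ dist m y = dist x y - t := by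
  obtain ⟨s, c, c0, c1, hc, -⟩ := hT.1 x y
  refine ⟨c t, ?_, ?_⟩
  · have := hc 0 ⟨le_rfl, dist_nonneg⟩ t ⟨h0, h1⟩
    rwa [c0, zero_sub, abs_neg, abs_of_nonneg h0] at this
  · have := hc t ⟨h0, h1⟩ _ ⟨dist_nonneg, le_rfl⟩
    rwa [c1, abs_sub_comm, abs_of_nonneg (by linarith)] at this

/-- Two points of a segment are at the distance given by their positions. -/
theorem IsRTree.dist_le_of_between (hT : IsRTree T) {x y u v : T} (hu : Between x u y)
    (hv : Between x v y) (h : dist x u ≤ dist x v) : dist u v = dist x v - dist x u := by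
  unfold Between at *
  have h1 := hT.fourPoint u v x y
  have h2 := dist_triangle x u v
  rcases max_choice (dist u y + dist x v) (dist v y + dist x u) with h3 | h3 <;>
    rw [h3] at h1 <;> linarith

theorem IsRTree.exists_median (hT : IsRTree T) (x y z : T) :
    ∃ m, Between x m y ∧ Between y m z ∧ Between x m z := by
  obtain ⟨m, h1, h2⟩ := hT.exists_between x y (t := (dist x y + dist x z - dist y z) / 2)
    (by linarith [dist_triangle y x z, dist_comm x y])
    (by linarith [dist_triangle x y z])
  have h3 := hT.fourPoint m z y x
  have h4 := hT.fourPoint m z x y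
  have e1 := dist_comm x y
  have e2 := dist_comm x z
  have e3 := dist_comm y z
  have e4 := dist_comm x m
  have e5 := dist_comm y m
  have t1 := dist_triangle x m z
  have t2 := dist_triangle y m z
  have t3 := dist_triangle x y z
  have t4 := dist_triangle y x z
  refine ⟨m, ?_, ?_, ?_⟩ <;> unfold Between
  · linarith
  · rcases max_choice (dist m y + dist x z) (dist z y + dist x m) with h5 | h5 <;>
      rw [h5] at h4 <;> linarith
  · rcases max_choice (dist m y + dist x z) (dist z y + dist x m) with h5 | h5 <;>
      rw [h5] at h4 <;> linarith

theorem IsRTree.median_unique (hT : IsRTree T) {x y z m m' : T} (h1 : Between x m y)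
    (h2 : Between y m z) (h3 : Between x m z) (h1' : Between x m' y)
    (h2' : Between y m' z) (h3' : Between x m' z) : m = m' := by
  have h4 : dist x m = dist x m' := by
    unfold Between at *
    linarith [dist_comm y m, dist_comm y m']
  rw [← dist_eq_zero, hT.dist_le_of_between h1 h1' h4.le, h4, sub_self]

/-- Not being separated by `m` is transitive. -/
theorem IsRTree.between_or (hT : IsRTree T) {x m z : T} (h : Between x m z) (y : T) :
    Between x m y ∨ Between y m z := by
  unfold Between at *
  have h1 := hT.fourPoint x z y m
  have t1 := dist_triangle x m y
  have t2 := dist_triangle y m z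
  have e1 := dist_comm y z
  have e2 := dist_comm y x
  have e3 := dist_comm m z
  have e4 := dist_comm m y
  rcases max_choice (dist x m + dist y z) (dist z m + dist y x) with h5 | h5 <;> rw [h5] at h1
  · exact Or.inr (by linarith)
  · exact Or.inl (by linarith)

/-- The points that are medians of triples of points of `O`. -/
def medianHull (O : Set T) : Set T :=
  {m | ∃ x ∈ O, ∃ y ∈ O, ∃ z ∈ O, Between x m y ∧ Between y m z ∧ Between x m z}

theorem subset_medianHull (O : Set T) : O ⊆ medianHull O :=
  fun x hx => ⟨x, hx, x, hx, x, hx, between_left _ _, between_left _ _, between_left _ _⟩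

/-- `v` lies between two points of `O`, and a point other than `v` cannot separate it from both. -/
theorem exists_not_between_of_mem_medianHull {O : Set T} {v m : T} (hv : v ∈ medianHull O)
    (hne : v ≠ m) : ∃ x ∈ O, ¬ Between v m x := by
  obtain ⟨x, hx, y, hy, z, -, h, -, -⟩ := hv
  by_contra! hcon
  have h1 := hcon x hx
  have h2 := hcon y hy
  unfold Between at *
  refine hne (dist_eq_zero.1 (le_antisymm ?_ dist_nonneg))
  linarith [dist_comm x v, dist_triangle x m y, dist_comm x m]

/-- Each of the three points, if different from `m`, can be replaced by a point of `O` on its own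
side of `m`, so one round of medians already gives a median-closed set. -/
theorem IsRTree.mem_medianHull (hT : IsRTree T) {O : Set T} {u v w m : T} (hu : u ∈ medianHull O)
    (hv : v ∈ medianHull O) (hw : w ∈ medianHull O) (h1 : Between u m v) (h2 : Between v m w)
    (h3 : Between u m w) : m ∈ medianHull O := by
  by_cases hum : u = m
  · exact hum ▸ hu
  by_cases hvm : v = m
  · exact hvm ▸ hv
  by_cases hwm : w = m
  · exact hwm ▸ hw
  obtain ⟨x, hx, hx'⟩ := exists_not_between_of_mem_medianHull hu hum
  obtain ⟨y, hy, hy'⟩ := exists_not_between_of_mem_medianHull hv hvm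
  obtain ⟨z, hz, hz'⟩ := exists_not_between_of_mem_medianHull hw hwm
  have key : ∀ {a b a' b' : T}, Between a m b → ¬ Between a m a' → ¬ Between b m b' →
      Between a' m b' := fun h ha hb =>
    ((hT.between_or (((hT.between_or h _).resolve_left ha).symm) _).resolve_left hb).symm
  exact ⟨x, hx, y, hy, z, hz, key h1 hx' hy', key h2 hy' hz', key h3 hx' hz'⟩

/-- A locally finite subset of an `ℝ`-tree that is closed under medians is a combinatorial tree. -/
theorem IsRTree.exists_rootedTree (hT : IsRTree T) {V : Set T}
    (hmed : ∀ u ∈ V, ∀ v ∈ V, ∀ w ∈ V, ∀ m, Between u m v → Between v m w → Between u m w → m ∈ V)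
    (hfin : ∀ v ∈ V, ∀ R : ℝ, {u | u ∈ V ∧ dist v u ≤ R}.Finite) (o : V) :
    ∃ τ : RootedTree V, ∀ v w : V, τ.Adj v w ↔
      v ≠ w ∧ ∀ u ∈ V, Between (v : T) u w → u = v ∨ u = w := by
  classical
  have fin : ∀ v : V, {u | u ∈ V ∧ Between (o : T) u v}.Finite := fun v =>
    (hfin o o.2 (dist (o : T) v)).subset fun u hu => ⟨hu.1, by
      have := hu.2
      unfold Between at this
      linarith [dist_nonneg (x := u) (y := (v : T))]⟩
  have hpar : ∀ v : V, v ≠ o → ∃ u : V, u ≠ v ∧ Between (o : T) u v ∧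
      ∀ w : V, w ≠ v → Between (o : T) w v → dist (o : T) w ≤ dist (o : T) u := by
    intro v hv
    obtain ⟨u, hu, hmax⟩ := Set.exists_max_image {u | u ∈ V ∧ Between (o : T) u v ∧ u ≠ v}
      (fun u => dist (o : T) u) ((fin v).subset fun u hu => ⟨hu.1, hu.2.1⟩)
      ⟨o, o.2, between_left _ _, fun h => hv (Subtype.ext h).symm⟩
    exact ⟨⟨u, hu.1⟩, fun h => hu.2.2 (congrArg Subtype.val h), hu.2.1,
      fun w hw hb => hmax w ⟨w.2, hb, fun h => hw (Subtype.ext h)⟩⟩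
  choose! par hpne hpb hpmax using hpar
  let τ : RootedTree V :=
    { root := o
      parent := par
      rank := fun v => {u | u ∈ V ∧ Between (o : T) u v}.ncard
      rank_parent_lt := by
        intro v hv
        have hb := hpb v hv
        refine Set.ncard_lt_ncard ⟨?_, ?_⟩ (fin v)
        · rintro u ⟨hu, hub⟩
          refine ⟨hu, ?_⟩
          unfold Between at *
          linarith [dist_triangle u (par v) (v : T), dist_triangle (o : T) u v]
        · intro hsub
          have h1 := (hsub ⟨v.2, between_right _ _⟩).2
          refine hpne v hv (Subtype.ext (dist_eq_zero.1 (le_antisymm ?_ dist_nonneg)))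
          unfold Between at *
          linarith [dist_comm (v : T) (par v), dist_nonneg (x := (v : T)) (y := par v)] }
  refine ⟨τ, ?_⟩
  have adjpar : ∀ v : V, v ≠ o → ∀ u ∈ V, Between (par v : T) u v → u = par v ∨ u = v := by
    intro v hv u hu hb
    by_contra! hcon
    have h1 := hpb v hv
    have h2 := hpmax v hv ⟨u, hu⟩ (fun h => hcon.2 (congrArg Subtype.val h))
    refine hcon.1 (dist_eq_zero.1 (le_antisymm ?_ dist_nonneg))
    unfold Between at *
    have t1 := dist_triangle (o : T) u v
    have t2 := dist_triangle (o : T) (par v) u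
    have h3 := h2 (by linarith)
    have e := dist_comm u (par v : T)
    simp only at h3
    linarith
  have main : ∀ v w : V, v ≠ w → (∀ u ∈ V, Between (v : T) u w → u = v ∨ u = w) →
      Between (o : T) v w → w ≠ o ∧ par w = v := by
    intro v w hvw hadj hb
    have hw : w ≠ o := by
      rintro rfl
      exact hvw (Subtype.ext hb.eq_of_self)
    refine ⟨hw, ?_⟩
    have h1 := hpb w hw
    have h2 := hpmax w hw v hvw hb
    have h3 := hT.dist_le_of_between hb h1 h2
    have h4 : Between (v : T) (par w) w := by
      unfold Between at *
      linarith
    rcases hadj _ (par w).2 h4 with h5 | h5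
    · exact Subtype.ext h5
    · exact absurd (Subtype.ext h5) (hpne w hw)
  intro v w
  constructor
  · rintro (⟨hw, rfl⟩ | ⟨hv, rfl⟩)
    · exact ⟨hpne w hw, adjpar w hw⟩
    · exact ⟨(hpne v hv).symm, fun u hu hb => (adjpar v hv u hu hb.symm).symm⟩
  · rintro ⟨hne, hadj⟩
    -- The median lies in `V` between neighbours, so it is one of them, and that one is the parent
    -- of the other.
    obtain ⟨m, h1, h2, h3⟩ := hT.exists_median (o : T) v w
    rcases hadj m (hmed _ o.2 _ v.2 _ w.2 m h1 h2 h3) h2 with rfl | rfl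
    · exact Or.inl (main v w hne hadj h3)
    · exact Or.inr (main w v hne.symm (fun u hu hb => (hadj u hu hb.symm).symm) h1)

/-- Helly's theorem for convex subsets of an `ℝ`-tree. -/
theorem IsRTree.helly (hT : IsRTree T) {ι : Type*} {s : Finset ι} (hs : s.Nonempty) :
    ∀ C : ι → Set T, (∀ i, ∀ x ∈ C i, ∀ y ∈ C i, ∀ m, Between x m y → m ∈ C i) →
      (∀ i j, (C i ∩ C j).Nonempty) → ∃ x, ∀ i ∈ s, x ∈ C i := by
  induction hs using Finset.Nonempty.cons_induction with
  | singleton a =>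
    intro C _ hC
    obtain ⟨x, hx, -⟩ := hC a a
    exact ⟨x, by simpa using hx⟩
  | cons a s ha hs ih =>
    intro C hconv hC
    -- Medians of points chosen in the pairwise intersections show that the sets still meet pairwise
    -- after intersecting with `C a`.
    obtain ⟨x, hx⟩ := ih (fun i => C i ∩ C a)
      (fun i x hx y hy m hm => ⟨hconv i x hx.1 y hy.1 m hm, hconv a x hx.2 y hy.2 m hm⟩) (by
        intro i j
        obtain ⟨x, hx, hx'⟩ := hC i a
        obtain ⟨y, hy, hy'⟩ := hC a j
        obtain ⟨z, hz, hz'⟩ := hC i j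
        obtain ⟨m, h1, h2, h3⟩ := hT.exists_median x y z
        exact ⟨m, ⟨hconv i x hx z hz m h3, hconv a x hx' y hy m h1⟩,
          hconv j y hy' z hz' m h2, hconv a x hx' y hy m h1⟩)
    refine ⟨x, fun i hi => ?_⟩
    rcases Finset.mem_cons.1 hi with rfl | hi
    · obtain ⟨j, hj⟩ := hs
      exact (hx j hj).2
    · exact (hx i hi).1

end RTree

/-! ### Proper actions on `ℝ`-trees -/

section ProperAction

variable {Γ : Type*} [Group Γ] {T : Type*} [MetricSpace T] [MulAction Γ T]

theorem orbitPseudoMetric_apply (p : T) (x y : Γ) :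
    orbitPseudoMetric Γ p x y = dist (x • p) (y • p) := rfl

theorem isLeftInvariant_orbitPseudoMetric [IsIsometricSMul Γ T] (p : T) :
    IsLeftInvariant (orbitPseudoMetric Γ p) := by
  intro h x y
  simp only [orbitPseudoMetric_apply, mul_smul, dist_smul]

theorem IsRTree.isDeltaHyperbolic_orbitPseudoMetric (hT : IsRTree T) (p : T) :
    IsDeltaHyperbolic 0 (orbitPseudoMetric Γ p) :=
  fun x y z w => hT.2 (x • p) (y • p) (z • p) (w • p)

/-- Along a word geodesic from `y` to `x`, the first orbit point on the side of `x` has crossed `m`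
in one step of length at most `K`. It can replace `x` in any separation statement about `m`. -/
theorem IsRTree.exists_near_of_between (hT : IsRTree T) [IsIsometricSMul Γ T] {p : T} {K : ℝ}
    {S : Set Γ} (hS : IsFiniteSymmGen S)
    (hK : ∀ x y : Γ, dist (x • p) (y • p) ≤ K * wordDist S x y) (hK0 : 0 ≤ K) {x y : Γ} {m : T}
    (h : Between (x • p) m (y • p)) :
    ∃ x' : Γ, dist (x' • p) m ≤ K ∧ ∀ u : T, Between (x • p) m u → Between (x' • p) m u := by
  classical
  by_cases hx : x • p = m
  · exact ⟨x, by simpa [hx] using hK0, fun u hu => hu⟩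
  obtain ⟨n, f, f0, fn, hf⟩ := hS.exists_wordGeodesic y x
  have hex : ∃ i, ¬ Between (x • p) m (f i • p) := ⟨n, by
    rw [fn]
    exact fun h => hx h.eq_of_self.symm⟩
  have hle : Nat.find hex ≤ n := Nat.find_min' hex (by
    rw [fn]
    exact fun h => hx h.eq_of_self.symm)
  have hspec := Nat.find_spec hex
  have hpos : 0 < Nat.find hex := by
    rw [Nat.pos_iff_ne_zero]
    intro h0
    rw [h0, f0] at hspec
    exact hspec h
  have hprev := not_not.1 (Nat.find_min hex (Nat.sub_lt hpos one_pos))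
  set i := Nat.find hex
  refine ⟨f i, ?_, fun u hu => (hT.between_or hu _).resolve_left hspec⟩
  have h1 := (hT.between_or hprev (f i • p)).resolve_left hspec
  have h2 := hK (f i) (f (i - 1))
  rw [hf i hle (i - 1) (by omega), Nat.cast_sub hpos] at h2
  unfold Between at h1
  have h3 := dist_nonneg (x := m) (y := f (i - 1) • p)
  simp at h2
  linarith

/-- A finitely generated group with a metrically proper action on an `ℝ`-tree is virtually
free. -/
theorem IsRTree.isVirtuallyFree_of_proper (hT : IsRTree T) [IsIsometricSMul Γ T] {S : Set Γ}
    (hS : IsFiniteSymmGen S) (p : T)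
    (hproper : ∀ R : ℝ, {g : Γ | dist (g • p) p ≤ R}.Finite) : IsVirtuallyFree Γ := by
  obtain ⟨K, hK0, hK⟩ := (isLeftInvariant_orbitPseudoMetric (Γ := Γ) p).exists_le_wordDist hS
  simp only [orbitPseudoMetric_apply] at hK
  let V : SubMulAction Γ T :=
    { carrier := medianHull (Set.range fun g : Γ => g • p)
      smul_mem' := by
        rintro g m ⟨_, ⟨x, rfl⟩, _, ⟨y, rfl⟩, _, ⟨z, rfl⟩, h1, h2, h3⟩
        have e : ∀ a : Γ, (g * a) • p = g • a • p := fun a => mul_smul _ _ _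
        refine ⟨_, ⟨g * x, rfl⟩, _, ⟨g * y, rfl⟩, _, ⟨g * z, rfl⟩, ?_, ?_, ?_⟩ <;>
          simp only [e, between_smul_iff] <;> assumption }
  have near : ∀ m ∈ V, ∃ x y z : Γ, (dist (x • p) m ≤ K ∧ dist (y • p) m ≤ K ∧
      dist (z • p) m ≤ K) ∧ Between (x • p) m (y • p) ∧ Between (y • p) m (z • p) ∧
      Between (x • p) m (z • p) := by
    rintro m ⟨_, ⟨x, rfl⟩, _, ⟨y, rfl⟩, _, ⟨z, rfl⟩, h1, h2, h3⟩
    obtain ⟨x', hx, hx'⟩ := hT.exists_near_of_between hS hK hK0.le h1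
    obtain ⟨y', hy, hy'⟩ := hT.exists_near_of_between hS hK hK0.le h2
    obtain ⟨z', hz, hz'⟩ := hT.exists_near_of_between hS hK hK0.le h3.symm
    exact ⟨x', y', z', ⟨hx, hy, hz⟩, hx' _ (hy' _ h1.symm).symm,
      hy' _ (hz' _ h2.symm).symm, hx' _ (hz' _ h3.symm).symm⟩
  have hfin : ∀ v ∈ V, ∀ R : ℝ, {u | u ∈ V ∧ dist v u ≤ R}.Finite := by
    intro v hv R
    set F := {g : Γ | dist (g • p) p ≤ K + R + dist v p} with hF
    have hFf : F.Finite := hproper _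
    refine ((hFf.prod (hFf.prod hFf)).biUnion
      (t := fun q : Γ × Γ × Γ => {m | Between (q.1 • p) m (q.2.1 • p) ∧
        Between (q.2.1 • p) m (q.2.2 • p) ∧ Between (q.1 • p) m (q.2.2 • p)})
      (fun q _ => Set.Subsingleton.finite fun m hm m' hm' => hT.median_unique hm.1 hm.2.1 hm.2.2
        hm'.1 hm'.2.1 hm'.2.2)).subset ?_
    rintro m ⟨hm, hmR⟩
    obtain ⟨x, y, z, ⟨hx, hy, hz⟩, h⟩ := near m hm
    have mem : ∀ g : Γ, dist (g • p) m ≤ K → g ∈ F := by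
      intro g hg
      have t1 := dist_triangle (g • p) m p
      have t2 := dist_triangle m v p
      rw [dist_comm m v] at t2
      simp only [hF, Set.mem_ofPred_eq]
      linarith
    exact Set.mem_biUnion (x := (x, y, z)) ⟨mem x hx, mem y hy, mem z hz⟩ h
  have hp : p ∈ V := subset_medianHull _ ⟨1, one_smul _ _⟩
  obtain ⟨τ, hτ⟩ := hT.exists_rootedTree (V := (V : Set T))
    (fun u hu v hv w hw m h1 h2 h3 => hT.mem_medianHull hu hv hw h1 h2 h3) hfin ⟨p, hp⟩
  -- Non-empty by `near`; a left translate of it lies in the ball of radius `2 * K`, finite by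
  -- properness, which bounds all sizes at once.
  let B : V → Set Γ := fun v => {g | dist (g • p) (v : T) ≤ K}
  have hBB : ∀ v : V, ∃ g₀ : Γ, B v ⊆ (fun a => g₀ * a) '' {g : Γ | dist (g • p) p ≤ 2 * K} := by
    intro v
    obtain ⟨x, -, -, ⟨hx, -, -⟩, -⟩ := near v v.2
    refine ⟨x, fun g hg => ⟨x⁻¹ * g, ?_, by simp⟩⟩
    have h1 : dist (g • p) (v : T) ≤ K := hg
    simp only [Set.mem_ofPred_eq, mul_smul]
    rw [← dist_smul x, smul_inv_smul]
    linarith [dist_triangle_right (g • p) (x • p) (v : T)]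
  refine τ.isVirtuallyFree (G := Γ) (V := V) ?_ B ?_ ?_ ?_
    {g : Γ | dist (g • p) p ≤ 2 * K}.ncard ?_
  · intro g v w h
    rw [hτ] at h ⊢
    refine ⟨fun e => h.1 (MulAction.injective g e), fun u hu hb => ?_⟩
    have h1 := h.2 (g⁻¹ • u) (V.smul_mem g⁻¹ hu) (by
      rw [← between_smul_iff g, smul_inv_smul]
      exact hb)
    rw [inv_smul_eq_iff, inv_smul_eq_iff] at h1
    exact h1
  · intro g v
    ext a
    constructor
    · intro ha
      refine ⟨g⁻¹ * a, ?_, by simp⟩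
      have ha' : dist (a • p) (g • (v : T)) ≤ K := ha
      change dist ((g⁻¹ * a) • p) (v : T) ≤ K
      rwa [mul_smul, ← dist_smul g, smul_inv_smul]
    · rintro ⟨b, hb, rfl⟩
      change dist ((g * b) • p) (g • (v : T)) ≤ K
      rw [mul_smul, dist_smul]
      exact hb
  · intro v
    obtain ⟨x, -, -, ⟨hx, -, -⟩, -⟩ := near v v.2
    exact ⟨x, hx⟩
  · intro v
    obtain ⟨g₀, h⟩ := hBB v
    exact ((hproper _).image _).subset h
  · intro v
    obtain ⟨g₀, h⟩ := hBB v
    exact (Set.ncard_le_ncard h ((hproper _).image _)).trans (Set.ncard_image_le (hproper _))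

theorem IsRTree.isVirtuallyFree_of_orbitPseudoMetric_mem (hT : IsRTree T) [IsIsometricSMul Γ T]
    (p : T) (h : orbitPseudoMetric Γ p ∈ metricSpaceD Γ) : IsVirtuallyFree Γ := by
  obtain ⟨-, -, S, hS, L, C, hL, hC, hLC⟩ := h
  refine hT.isVirtuallyFree_of_proper hS p fun R => ?_
  refine (hS.finite_wordLength_le ⌊L * (R + C)⌋₊).subset ?_
  intro g hg
  have h1 := (hLC 1 g).1
  rw [orbitPseudoMetric_apply, one_smul, dist_comm] at h1
  have h2 : wordDist S 1 g ≤ L * (R + C) := by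
    rw [← inv_mul_le_iff₀ hL]
    have : dist (g • p) p ≤ R := hg
    linarith
  simp only [wordDist, inv_one, one_mul] at h2
  exact Nat.le_floor h2

end ProperAction

/-! ### Elliptic isometries and global fixed points -/

section FixedPoint

variable {Γ : Type*} [Group Γ]

theorem stableLength_one (d : PseudoMetric Γ ℝ) : stableLength d 1 = 0 := by
  simp only [stableLength, one_pow, PseudoMetric.refl, zero_div]
  exact tendsto_const_nhds.limUnder_eq

/-- Little backtracking at one step of the orbit of powers propagates by the local-to-global
principle with `s = 1`, so each further power adds at least `d 1 g - 2 * C`. -/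
theorem stableLength_pos {d : PseudoMetric Γ ℝ} (hd : IsLeftInvariant d)
    (h : IsDeltaHyperbolic 0 d) {g : Γ} (hg : 2 * gromovProduct d g 1 (g * g) < d 1 g) :
    0 < stableLength d g := by
  set C := gromovProduct d g 1 (g * g) with hC
  have step : ∀ i : ℕ, d (g ^ i) (g ^ (i + 1)) = d 1 g := fun i => by
    have := hd (g ^ i) 1 g
    rwa [mul_one, ← pow_succ] at this
  have key : ∀ i : ℕ, gromovProduct d (g ^ i) (g ^ 0) (g ^ (i + 1)) ≤ C := by
    intro i
    have := h.gromovProduct_le_of_local (C := C) (s := 1) (n := i + 1) one_pos (f := fun i => g ^ i)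
      le_rfl ?_ ?_ ?_ i le_rfl
    · simpa using this
    · intro j hj _
      obtain rfl : j = 0 := by omega
      have := gromovProduct_nonneg d g 1 (g * g)
      rw [← hC] at this
      simp only [gromovProduct, d.refl]
      linarith
    · intro j _
      refine le_of_eq ?_
      have := hd.gromovProduct_mul (g ^ j) g 1 (g * g)
      rw [mul_one, ← mul_assoc, ← pow_succ, ← pow_succ] at this
      exact this
    · intro j _
      rw [step]
      linarith
  have lower : ∀ n : ℕ, n * (d 1 g - 2 * C) ≤ d 1 (g ^ n) := by
    intro n
    induction n with
    | zero => simp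
    | succ n ih =>
      have h1 := key n
      have h2 := step n
      rw [pow_zero] at h1
      unfold gromovProduct at h1
      push_cast
      linarith
  refine lt_of_lt_of_le (sub_pos.2 hg) (ge_of_tendsto (tendsto_stableLength hd g) ?_)
  filter_upwards [eventually_gt_atTop 0] with n hn
  rw [le_div_iff₀ (by exact_mod_cast hn), mul_comm]
  exact lower n

variable {T : Type*} [MetricSpace T] [MulAction Γ T] [IsIsometricSMul Γ T]

theorem orbitPseudoMetric_le_add (p q : T) (x y : Γ) :
    orbitPseudoMetric Γ p x y ≤ orbitPseudoMetric Γ q x y + 2 * dist p q := by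
  simp only [orbitPseudoMetric_apply]
  have h1 := dist_triangle (x • p) (x • q) (y • p)
  have h2 := dist_triangle (x • q) (y • q) (y • p)
  rw [dist_smul] at h1
  rw [dist_smul y, dist_comm q p] at h2
  linarith

theorem stableLength_orbitPseudoMetric_le (p q : T) (g : Γ) :
    stableLength (orbitPseudoMetric Γ p) g ≤ stableLength (orbitPseudoMetric Γ q) g := by
  have h1 := tendsto_stableLength (isLeftInvariant_orbitPseudoMetric (Γ := Γ) p) g
  have h2 := (tendsto_stableLength (isLeftInvariant_orbitPseudoMetric (Γ := Γ) q) g).add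
    (tendsto_const_div_atTop_nhds_zero_nat (2 * dist p q))
  rw [add_zero] at h2
  refine le_of_tendsto_of_tendsto' h1 h2 fun n => ?_
  rw [← add_div]
  exact div_le_div_of_nonneg_right (orbitPseudoMetric_le_add p q 1 (g ^ n)) (Nat.cast_nonneg n)

/-- With zero stable length, the segments from `g • q` to `q` and to `g • g • q` share at least
their halves next to `g • q`, so their midpoints `m` and `g • m` coincide. -/
theorem IsRTree.smul_midpoint_eq (hT : IsRTree T) {p : T} {g : Γ}
    (hg : stableLength (orbitPseudoMetric Γ p) g = 0) {q m : T} (h1 : dist q m = dist q (g • q) / 2)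
    (h2 : dist m (g • q) = dist q (g • q) / 2) : g • m = m := by
  have hq : stableLength (orbitPseudoMetric Γ q) g ≤ 0 :=
    (stableLength_orbitPseudoMetric_le q p g).trans hg.le
  have h3 : ¬ 2 * gromovProduct (orbitPseudoMetric Γ q) g 1 (g * g) <
      orbitPseudoMetric Γ q 1 g := fun h =>
    absurd (stableLength_pos (isLeftInvariant_orbitPseudoMetric q)
      (hT.isDeltaHyperbolic_orbitPseudoMetric q) h) hq.not_gt
  simp only [gromovProduct, orbitPseudoMetric_apply, one_smul, mul_smul, dist_smul] at h3
  have e1 : dist (g • q) (g • m) = dist q (g • q) / 2 := by rw [dist_smul, h1]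
  have e2 : dist (g • m) (g • g • q) = dist q (g • q) / 2 := by rw [dist_smul, h2]
  have e3 : dist (g • q) (g • g • q) = dist q (g • q) := dist_smul _ _ _
  have f1 := hT.fourPoint (g • m) q (g • q) (g • g • q)
  have f2 := hT.fourPoint m (g • m) (g • q) q
  rw [dist_comm (g • q) q] at f1 f2
  rw [dist_comm m q, dist_comm (g • q) m] at f2
  have f3 : dist (g • m) q ≤ dist q (g • q) / 2 := by
    rcases max_choice (dist (g • m) (g • g • q) + dist q (g • q))
      (dist q (g • g • q) + dist (g • q) (g • m)) with h | h <;> rw [h] at f1 <;> linarith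
  refine (dist_eq_zero.1 (le_antisymm ?_ dist_nonneg)).symm
  rcases max_choice (dist q m + dist (g • q) (g • m)) (dist (g • m) q + dist m (g • q)) with h | h <;>
    rw [h] at f2 <;> linarith

theorem IsRTree.exists_midpoint (hT : IsRTree T) (x y : T) :
    ∃ m, dist x m = dist x y / 2 ∧ dist m y = dist x y / 2 := by
  obtain ⟨m, h1, h2⟩ := hT.exists_between x y (t := dist x y / 2) (by positivity)
    (by linarith [dist_nonneg (x := x) (y := y)])
  exact ⟨m, h1, by rw [h2]; ring⟩

/-- If every element is elliptic, then any two elements have a common fixed point. -/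
theorem IsRTree.exists_common_fixed_point (hT : IsRTree T) (p : T)
    (h : ∀ g : Γ, stableLength (orbitPseudoMetric Γ p) g = 0) (a b : Γ) :
    ∃ m : T, a • m = m ∧ b • m = m := by
  obtain ⟨q, hq1, hq2⟩ := hT.exists_midpoint p ((a * b) • p)
  have hq := hT.smul_midpoint_eq (h (a * b)) hq1 hq2
  -- Since `a * b` fixes `q`, one midpoint serves both `b` and `a⁻¹`.
  have hab : a⁻¹ • q = b • q := by rw [inv_smul_eq_iff, ← mul_smul, hq]
  obtain ⟨m, hm1, hm2⟩ := hT.exists_midpoint q (b • q)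
  have hb := hT.smul_midpoint_eq (h b) hm1 hm2
  rw [← hab] at hm1 hm2
  have ha := hT.smul_midpoint_eq (h a⁻¹) hm1 hm2
  exact ⟨m, (inv_smul_eq_iff.1 ha).symm, hb⟩

/-- A finitely generated group acting on an `ℝ`-tree without global fixed point contains a
hyperbolic element. -/
theorem IsRTree.exists_stableLength_ne (hT : IsRTree T) {S : Set Γ} (hS : IsFiniteSymmGen S)
    (hfix : ¬ ∃ p : T, ∀ g : Γ, g • p = p) (p : T) :
    ¬ ∃ c : ℝ, ∀ x : Γ, stableLength (orbitPseudoMetric Γ p) x = c := by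
  classical
  rintro ⟨c, hc⟩
  have hc0 : ∀ x : Γ, stableLength (orbitPseudoMetric Γ p) x = 0 := fun x => by
    rw [hc x, ← hc 1, stableLength_one]
  -- Helly applied to the convex fixed sets of the generators; inserting 1 keeps the family
  -- non-empty.
  obtain ⟨m, hm⟩ := hT.helly (s := insert 1 hS.finite.toFinset) ⟨1, by simp⟩
    (fun g : Γ => {x : T | g • x = x}) (by
      intro g x hx y hy m hm
      have hx' : g • x = x := hx
      have hy' : g • y = y := hy
      have h1 := hm.smul g
      rw [hx', hy'] at h1
      have h2 : dist x m = dist x (g • m) := by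
        conv_rhs => rw [← hx', dist_smul]
      have h3 := hT.dist_le_of_between hm h1 h2.le
      rw [h2, sub_self, dist_eq_zero] at h3
      exact h3.symm)
    (fun a b => hT.exists_common_fixed_point p hc0 a b)
  refine hfix ⟨m, fun g => ?_⟩
  have hle : Subgroup.closure S ≤ MulAction.stabilizer Γ m := by
    rw [Subgroup.closure_le]
    intro s hs
    exact hm s (by simp [hs])
  rw [hS.generates] at hle
  exact hle (Subgroup.mem_top g)

end FixedPoint

/-! ### Bounded backtracking and the closure of `𝒟_Γ` -/

section Backtracking

variable {Γ : Type*} [Group Γ] {T : Type*} [MetricSpace T] [MulAction Γ T]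

theorem IsRTree.hasBoundedBacktrackingAt_of_mem_closureD (hT : IsRTree T) {p : T}
    (h : orbitPseudoMetric Γ p ∈ closureD Γ) {S : Set Γ} (hS : IsFiniteSymmGen S) :
    HasBoundedBacktrackingAt S p := by
  classical
  obtain ⟨hinv, -, lam, hlam, d₀, hd₀, hle⟩ := h
  obtain ⟨K, hK0, hK⟩ := hinv.exists_le_wordDist hS
  obtain ⟨C, hC0, hC⟩ := exists_gromovProduct_le_of_wordGeodesic hd₀ hS
  refine ⟨max K (lam * C + lam), le_max_of_le_left hK0.le, ?_⟩
  rintro x _ ⟨n, f, f0, fn, hf, rfl⟩ _ ⟨c, c0, c1, hc, rfl⟩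
  have pos : ∀ t ∈ Set.Icc 0 (dist p (x • p)), dist p (c t) = t ∧
      dist (c t) (x • p) = dist p (x • p) - t := by
    intro t ht
    constructor
    · have := hc 0 ⟨le_rfl, dist_nonneg⟩ t ht
      rwa [c0, zero_sub, abs_neg, abs_of_nonneg ht.1] at this
    · have := hc t ht _ ⟨dist_nonneg, le_rfl⟩
      rwa [c1, abs_sub_comm, abs_of_nonneg (by linarith [ht.2])] at this
  constructor
  · rintro _ ⟨_, ⟨i, hi, rfl⟩, rfl⟩
    -- Left invariance moves the comparison from the identity to the base point `f i`; the tree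
    -- product there equals the distance from `f i • p` to the segment, attained at parameter `t`.
    have h1 := hle ((f i)⁻¹ * f 0) ((f i)⁻¹ * f n)
    have h2 : ∀ d : PseudoMetric Γ ℝ, IsLeftInvariant d →
        gromovProduct d 1 ((f i)⁻¹ * f 0) ((f i)⁻¹ * f n) = gromovProduct d (f i) (f 0) (f n) := by
      intro d hd
      rw [← hd.gromovProduct_mul (f i)⁻¹ (f i), inv_mul_cancel]
    rw [h2 _ hinv, h2 _ hd₀.1] at h1
    have h3 : gromovProduct (orbitPseudoMetric Γ p) (f i) (f 0) (f n) ≤ lam * C + lam := by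
      refine h1.trans ?_
      gcongr
      exact hC f n hf i hi
    simp only [gromovProduct, orbitPseudoMetric_apply, f0, fn, one_smul] at h3
    set t := (dist p (f i • p) + dist p (x • p) - dist (f i • p) (x • p)) / 2 with ht
    have htm : t ∈ Set.Icc 0 (dist p (x • p)) := by
      constructor
      · linarith [dist_triangle_left (f i • p) (x • p) p]
      · linarith [dist_triangle p (x • p) (f i • p), dist_comm (x • p) (f i • p)]
    obtain ⟨e1, e2⟩ := pos t htm
    refine ⟨c t, ⟨t, htm, rfl⟩, le_max_of_le_right (le_trans ?_ h3)⟩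
    have h4 := hT.fourPoint (f i • p) (c t) p (x • p)
    have e3 := dist_comm p (f i • p)
    rcases max_choice (dist (f i • p) (x • p) + dist p (c t))
      (dist (c t) (x • p) + dist p (f i • p)) with h5 | h5 <;> rw [h5] at h4 <;> linarith
  · rintro _ ⟨t, ht, rfl⟩
    obtain ⟨e1, e2⟩ := pos t ht
    have hb : Between p (c t) (f n • p) := by
      rw [fn]
      unfold Between
      linarith
    -- The first orbit point beyond `c t` has crossed it in one step of length at most `K`.
    have hex : ∃ i, Between p (c t) (f i • p) := ⟨n, hb⟩
    have hle' : Nat.find hex ≤ n := Nat.find_min' hex hb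
    have hspec := Nat.find_spec hex
    refine ⟨f (Nat.find hex) • p, ⟨_, ⟨_, hle', rfl⟩, rfl⟩, le_max_of_le_left ?_⟩
    rcases Nat.eq_zero_or_pos (Nat.find hex) with h0 | h0
    · rw [h0, f0, one_smul] at hspec ⊢
      rw [hspec.eq_of_self, dist_self]
      exact hK0.le
    · have h1 := Nat.find_min hex (Nat.sub_lt h0 one_pos)
      set i := Nat.find hex
      have h2 := (hT.between_or hspec (f (i - 1) • p)).resolve_left h1
      have h3 := hK (f (i - 1)) (f i)
      rw [hf (i - 1) (by omega) i hle', Nat.cast_sub h0, orbitPseudoMetric_apply] at h3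
      unfold Between at h2
      simp at h3
      rw [dist_comm]
      linarith [dist_nonneg (x := f (i - 1) • p) (y := c t)]

variable [IsIsometricSMul Γ T]

theorem IsRTree.gromovProduct_le_of_hasBoundedBacktrackingAt (hT : IsRTree T) {p : T} {S : Set Γ}
    (h : HasBoundedBacktrackingAt S p) :
    ∃ C, 0 ≤ C ∧ ∀ (f : ℕ → Γ) (n : ℕ),
      (∀ i ≤ n, ∀ j ≤ n, wordDist S (f i) (f j) = |(i : ℝ) - (j : ℝ)|) →
      ∀ i ≤ n, gromovProduct (orbitPseudoMetric Γ p) (f i) (f 0) (f n) ≤ C := by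
  obtain ⟨C, hC, H⟩ := h
  refine ⟨C, hC, fun f n hf i hi => ?_⟩
  have hinv := isLeftInvariant_orbitPseudoMetric (Γ := Γ) p
  rw [← hinv.gromovProduct_mul (f 0)⁻¹, inv_mul_cancel]
  obtain ⟨s, hs⟩ := hT.1 p (((f 0)⁻¹ * f n) • p)
  have h1 := (H ((f 0)⁻¹ * f n) _ ⟨n, fun i => (f 0)⁻¹ * f i, inv_mul_cancel _, rfl, fun i hi j hj => by
    rw [← hf i hi j hj]
    simp only [wordDist]
    congr 2
    group, rfl⟩ s hs).1 (((f 0)⁻¹ * f i) • p) ⟨_, ⟨i, hi, rfl⟩, rfl⟩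
  obtain ⟨b, hb, hd⟩ := h1
  obtain ⟨c, c0, c1, hc, rfl⟩ := hs
  obtain ⟨t, ht, rfl⟩ := hb
  have e1 := hc 0 ⟨le_rfl, dist_nonneg⟩ t ht
  rw [c0, zero_sub, abs_neg, abs_of_nonneg ht.1] at e1
  have e2 := hc t ht _ ⟨dist_nonneg, le_rfl⟩
  rw [c1, abs_sub_comm, abs_of_nonneg (by linarith [ht.2])] at e2
  simp only [gromovProduct, orbitPseudoMetric_apply, one_smul]
  have t1 := dist_triangle_right p (((f 0)⁻¹ * f i) • p) (c t)
  have t2 := dist_triangle (((f 0)⁻¹ * f i) • p) (c t) (((f 0)⁻¹ * f n) • p)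
  linarith

theorem IsRTree.orbitPseudoMetric_mem_closureD (hT : IsRTree T) (hΓ : IsHyperbolicGroup Γ)
    (hfix : ¬ ∃ p : T, ∀ g : Γ, g • p = p) (h : HasBoundedBacktracking T Γ) (p : T) :
    orbitPseudoMetric Γ p ∈ closureD Γ := by
  obtain ⟨S₀, hS₀, hyp⟩ := hΓ
  obtain ⟨S, hS, q, hq⟩ := h
  have hd₀ := wordPseudoMetric_mem_metricSpaceD hS₀ hyp
  obtain ⟨C, hC0, hC⟩ := hT.gromovProduct_le_of_hasBoundedBacktrackingAt hq
  obtain ⟨L, A, hL, hA, H⟩ := exists_wordLength_le_gromovProduct hd₀ hS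
  obtain ⟨K, hK0, hK⟩ := (isLeftInvariant_orbitPseudoMetric (Γ := Γ) q).exists_le_wordDist hS
  have hD : 0 ≤ dist p q := dist_nonneg
  have hKA : 0 ≤ K * A := by positivity
  have hKL : 0 < K * L := by positivity
  refine ⟨isLeftInvariant_orbitPseudoMetric p, hT.exists_stableLength_ne hS hfix p,
    K * L + K * A + C + 3 * dist p q, by linarith, _, hd₀, fun x y => ?_⟩
  set P := gromovProduct (wordPseudoMetric S₀ hS₀) 1 x y with hP
  have hP0 : 0 ≤ P := gromovProduct_nonneg _ _ _ _
  obtain ⟨n, f, f0, fn, hf⟩ := hS.exists_wordGeodesic x y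
  obtain ⟨i, hi, hiP⟩ := H f n hf
  rw [f0, fn, ← hP] at hiP
  have h1 := hC f n hf i hi
  rw [f0, fn] at h1
  -- Moving the base point from `f i` to the identity costs at most `K` times the word length of `f
  -- i`, which `hiP` bounds linearly in `P`.
  have h2 := gromovProduct_le_add (orbitPseudoMetric Γ q) 1 (f i) x y
  have h3 := hK 1 (f i)
  have h4 : K * wordDist S 1 (f i) ≤ K * (L * P + A) := by gcongr
  have h5 : gromovProduct (orbitPseudoMetric Γ p) 1 x y ≤
      gromovProduct (orbitPseudoMetric Γ q) 1 x y + 3 * dist p q := by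
    have a1 := orbitPseudoMetric_le_add p q x 1
    have a2 := orbitPseudoMetric_le_add p q 1 y
    have a3 := orbitPseudoMetric_le_add q p x y
    rw [dist_comm q p] at a3
    unfold gromovProduct
    linarith
  have h6 : 0 ≤ (K * A + C + 3 * dist p q) * P := by positivity
  calc gromovProduct (orbitPseudoMetric Γ p) 1 x y
      ≤ K * (L * P + A) + C + 3 * dist p q := by linarith
    _ ≤ _ := by linarith

end Backtracking

end HypGroup

end

theorem mainTheorem12 {Γ : Type*} [Group Γ]
    (hΓ : HypGroup.IsHyperbolicGroup Γ) (hne : HypGroup.IsNonElementary Γ)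
    {T : Type*} [MetricSpace T] [Nonempty T] (hT : HypGroup.IsRTree T)
    [MulAction Γ T] [IsIsometricSMul Γ T]
    (hfix : ¬ ∃ p : T, ∀ g : Γ, g • p = p) :
    -- bounded backtracking does not depend on the generating set or on the base point
    (HypGroup.HasBoundedBacktracking T Γ ↔
      ∀ S : Set Γ, HypGroup.IsFiniteSymmGen S →
        ∀ p : T, HypGroup.HasBoundedBacktrackingAt S p) ∧
    (∀ p : T, HypGroup.orbitPseudoMetric Γ p ∈ HypGroup.closureD Γ ↔
      HypGroup.HasBoundedBacktracking T Γ) ∧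
    (¬ HypGroup.IsVirtuallyFree Γ → HypGroup.HasBoundedBacktracking T Γ →
      ∀ p : T, HypGroup.orbitPseudoMetric Γ p ∈ HypGroup.manhattanBoundaryD Γ) := by
  have bbt : HypGroup.HasBoundedBacktracking T Γ → ∀ S : Set Γ, HypGroup.IsFiniteSymmGen S →
      ∀ p : T, HypGroup.HasBoundedBacktrackingAt S p := fun h S hS p =>
    hT.hasBoundedBacktrackingAt_of_mem_closureD
      (hT.orbitPseudoMetric_mem_closureD hΓ hfix h p) hS
  obtain ⟨S, hS, -⟩ := id hΓ
  refine ⟨⟨bbt, fun h => ⟨S, hS, Classical.arbitrary T, h S hS _⟩⟩, fun p => ⟨fun h => ?_, fun h =>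
    hT.orbitPseudoMetric_mem_closureD hΓ hfix h p⟩, fun hvf h p =>
    ⟨hT.orbitPseudoMetric_mem_closureD hΓ hfix h p, fun hp =>
      hvf (hT.isVirtuallyFree_of_orbitPseudoMetric_mem p hp)⟩⟩
  exact ⟨S, hS, p, hT.hasBoundedBacktrackingAt_of_mem_closureD h hS⟩
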